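/- Work in $\mathbb{R}^n$. Let $\mathcal{L}_n$ be the set of lines $(p,0)+\mathbb{R}v$ with $p\in[-\frac1n,\frac1n]^{n-1}$ and $v\in S^{n-1}$, $v_n\ge \frac12$; put $d(l,l')=|p-p'|+\angle(v,v')$. For $\delta>0$, the $\delta$-tube $T$ with coaxial line $l\in\mathcal{L}_n$ is $N_{2n\delta}(l)\cap[-1,1]^n$, where $N_r(l)$ is the $r$-neighbourhood of $l$; its direction is $v(T)=v$. Two $\delta$-tubes are essentially distinct if $d(l,l')>\delta$ and essentially parallel if $\angle(v,v')\le\delta$. If $\delta\le\rho$, a $\rho$-tube with coaxial line $\tilde l$ covers a $\delta$-tube with coaxial line $l$ if $d(l,\tilde l)\le\rho/2$, and a set of $\rho$-tubes covers a set $\mathbb{T}$ of $\delta$-tubes if each tube of $\mathbb{T}$ is covered by a tube of that set. A $\delta$-cube is a set $[0,\delta)^n+q$ with $q\in(\delta\mathbb{Z})^n$. A pair $(\mathbb{T},Y)_\delta$ consists of a finite set $\mathbb{T}$ of $\delta$-tubes and, for each $T\in\mathbb{T}$, a shading $Y(T)\subset T$ that is a union of $\delta$-cubes. Let $\mathbb{T}_Y(Q)=\{T\in\mathbb{T}:Q\subset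 Y(T)\}$, let $\mathcal{Q}(Y)$ be the set of $\delta$-cubes that lie in some $Y(T)$, and put $$\lambda_Y=\frac1{\#\mathbb{T}}\sum_{T\in\mathbb{T}}\frac{|Y(T)|}{|T|},\qquad \mu_Y=\frac{\sum_{Q\in\mathcal{Q}(Y)}\#\mathbb{T}_Y(Q)}{\#\mathcal{Q}(Y)} .$$ For $s,t>0$, call $(\mathbb{T},Y)_\delta$ $(s,t)$-admissible if (a) the tubes of $\mathbb{T}$ are pairwise essentially distinct; (b) for each $\delta\le\rho\le1$, $\mathbb{T}$ is covered by a set of $\rho$-tubes such that, for each $\rho$-tube of that set, at most $\delta^{-t}$ of its $\rho$-tubes are essentially parallel to it; (c) $\sum_{T\in\mathbb{T}}|Y(T)|\ge\delta^s$. Let $M(s,t,\delta)$ be the infimum of $\big|\bigcup_{T\in\mathbb{T}}Y(T)\big|$ over all $(s,t)$-admissible pairs $(\mathbb{T},Y)_\delta$, and $$N(s,t)=\limsup_{\delta\to0^+}\frac{\log M(s,t,\delta)}{\log\delta},\qquad \sigma_n=\inf_{(s,t)\in(0,1)^2}N(s,t).$$ For $\eta>0$, $(\mathbb{T},Y)_\delta$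 is $\eta$-extremal if it is $(\eta,\eta)$-admissible and $\big|\bigcup_{T\in\mathbb{T}}Y(T)\big|\le\delta^{\sigma_n-\eta}$. A pair $(\mathbb{T}',Y')_\delta$ is a $t$-refinement of $(\mathbb{T},Y)_\delta$ if $\mathbb{T}'\subset\mathbb{T}$, $Y'(T)\subset Y(T)$ for all $T\in\mathbb{T}'$, and $\sum_{T\in\mathbb{T}'}|Y'(T)|\ge t\sum_{T\in\mathbb{T}}|Y(T)|$. A pair $(\mathbb{T},Y)_\delta$ is $(\epsilon_1,C_1)$-two-ends if $$\#\{Q: Q\subset Y(T)\cap B(x,r)\}\le r^{\epsilon_1}C_1\lambda_Y\delta^{-1}$$ for all $T\in\mathbb{T}$, all $\delta\le r\le1$ and all closed balls $B(x,r)$, where $Q$ runs over $\delta$-cubes; it is $(\epsilon_2,C_2)$-robustly transverse at all angles $\delta\le r\le1$ if $$\#\{T\in\mathbb{T}_Y(Q):\angle(v(T),v)\le r\}\le r^{\epsilon_2}C_2\mu_Y$$ for all $\delta$-cubes $Q$, all vectors $v$ and all $\delta\le r\le1$. **Statement.** Let $n=4$. For every $\epsilon>0$ there is $\eta_0>0$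 such that for every $0<\eta\le\eta_0$ there is $\delta_0>0$ with the following property. If $0<\delta<\delta_0$ and $(\mathbb{T},Y)_\delta$ is an $\eta$-extremal collection of $\delta$-tubes in $\mathbb{R}^4$, then $(\mathbb{T},Y)_\delta$ has a $\delta^{\eta}$-refinement that is $(1,\delta^{-4\eta})$-two-ends and $(\sigma_4,\delta^{-3\eta-3\epsilon})$-robustly transverse at all angles $\delta\le r\le1$. -/

import Mathlib

open Filter Topology MeasureTheory

namespace StickyKakeya

/-- Euclidean space `ℝⁿ`. -/
abbrev E (n : ℕ) : Type := EuclideanSpace ℝ (Fin n)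

/-- A line of the class `𝓛ₙ`: the line `(p, 0) + ℝ v`, with `(p, 0)` in the hyperplane where the
last coordinate vanishes and `p ∈ [-1/n, 1/n]^(n-1)`, and with a unit direction `v` whose last
coordinate is at least `1/2`.  The pair `(base, dir)` is determined by the line. The field `base`
holds the point `(p, 0)`; the condition `(i : ℕ) + 1 = n` says that `i` is the last index. -/
@[ext]
structure Line (n : ℕ) where
  base : E n
  dir : E n
  base_last : ∀ i : Fin n, (i : ℕ) + 1 = n → base i = 0
  base_le : ∀ i : Fin n, |base i| ≤ 1 / (n : ℝ)
  dir_norm : ‖dir‖ = 1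
  dir_last : ∀ i : Fin n, (i : ℕ) + 1 = n → 1 / 2 ≤ dir i

namespace Line

variable {n : ℕ}

/-- The points of the line. -/
def points (l : Line n) : Set (E n) := {x | ∃ a : ℝ, x = l.base + a • l.dir}

/-- `d(l, l') = |p - p'| + ∠(v, v')`. -/
noncomputable def d (l l' : Line n) : ℝ :=
  ‖l.base - l'.base‖ + InnerProductGeometry.angle l.dir l'.dir

/-- The `δ`-tube with coaxial line `l`: the part in `[-1, 1]ⁿ` of the `2nδ`-neighbourhood
of `l`. -/
def tube (δ : ℝ) (l : Line n) : Set (E n) :=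
  Metric.thickening (2 * n * δ) l.points ∩ {x | ∀ i, x i ∈ Set.Icc (-1 : ℝ) 1}

end Line

/-- The `δ`-cube `[0, δ)ⁿ + δ k`, for `k ∈ ℤⁿ`. -/
def cube (n : ℕ) (δ : ℝ) (k : Fin n → ℤ) : Set (E n) :=
  {x | ∀ i, x i ∈ Set.Ico (δ * k i) (δ * k i + δ)}

/-- A pair `(𝕋, Y)_δ`: a (finite) collection of `δ`-tubes, each of which is recorded by its coaxial
line, with a shading of each.  A shading is a union of `δ`-cubes that lies in the (bounded) tube,
hence a union of finitely many; `Y l` is the set of the indices of these cubes. -/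
structure ShadedTubes (n : ℕ) (δ : ℝ) where
  tubes : Finset (Line n)
  Y : Line n → Finset (Fin n → ℤ)
  subset_tube : ∀ l ∈ tubes, ∀ k ∈ Y l, cube n δ k ⊆ l.tube δ

namespace ShadedTubes

variable {n : ℕ} {δ : ℝ}

/-- The shading `Y(T)` as a subset of `ℝⁿ`. -/
def shading (C : ShadedTubes n δ) (l : Line n) : Set (E n) := ⋃ k ∈ C.Y l, cube n δ k

/-- The union of all shadings. -/
def union (C : ShadedTubes n δ) : Set (E n) := ⋃ l ∈ C.tubes, C.shading l

/-- The mass `∑ |Y(T)|`. -/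
noncomputable def mass (C : ShadedTubes n δ) : ℝ := ∑ l ∈ C.tubes, volume.real (C.shading l)

/-- The set `𝒬(Y)` of the (indices of the) `δ`-cubes in at least one shading. -/
def cubes (C : ShadedTubes n δ) : Finset (Fin n → ℤ) := C.tubes.biUnion C.Y

/-- The set `𝕋_Y(Q)` of the tubes whose shading contains the cube `Q` of index `k`. -/
def through (C : ShadedTubes n δ) (k : Fin n → ℤ) : Finset (Line n) :=
  C.tubes.filter fun l => k ∈ C.Y l

/-- The average density `λ_Y`. -/
noncomputable def density (C : ShadedTubes n δ) : ℝ :=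
  1 / (C.tubes.card : ℝ) *
    ∑ l ∈ C.tubes, volume.real (C.shading l) / volume.real (l.tube δ)

/-- The average multiplicity `μ_Y`. -/
noncomputable def multiplicity (C : ShadedTubes n δ) : ℝ :=
  (∑ k ∈ C.cubes, ((C.through k).card : ℝ)) / (C.cubes.card : ℝ)

/-- The tubes are pairwise essentially distinct. -/
def EssentiallyDistinct (C : ShadedTubes n δ) : Prop :=
  ∀ l ∈ C.tubes, ∀ l' ∈ C.tubes, l ≠ l' → δ < l.d l'

open Classical in
/-- For each `δ ≤ ρ ≤ 1`, the collection is covered by a set of `ρ`-tubes (a `ρ`-tube covers a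
`δ`-tube if `d(l, l') ≤ ρ / 2` for the coaxial lines), at most `δ^(-t)` of which are essentially
parallel to any given one of them (directions at angle at most `ρ`). -/
def StickyCovered (C : ShadedTubes n δ) (t : ℝ) : Prop :=
  ∀ ρ : ℝ, δ ≤ ρ → ρ ≤ 1 → ∃ U : Finset (Line n),
    (∀ l ∈ C.tubes, ∃ u ∈ U, l.d u ≤ ρ / 2) ∧
    ∀ u ∈ U, ((U.filter fun u' => InnerProductGeometry.angle u'.dir u.dir ≤ ρ).card : ℝ)
      ≤ δ ^ (-t)

/-- The class of pairs over which the infimum `M(s, t, δ)` is taken. -/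
structure Admissible (C : ShadedTubes n δ) (s t : ℝ) : Prop where
  distinct : C.EssentiallyDistinct
  sticky : C.StickyCovered t
  mass_ge : δ ^ s ≤ C.mass

/-- `C'` is a `t`-refinement of `C`. -/
structure IsRefinement (C' : ShadedTubes n δ) (t : ℝ) (C : ShadedTubes n δ) : Prop where
  tubes_subset : C'.tubes ⊆ C.tubes
  shading_subset : ∀ l ∈ C'.tubes, C'.shading l ⊆ C.shading l
  mass_ge : t * C.mass ≤ C'.mass

open Classical in
/-- The `(ε₁, C₁)`-two-ends condition. -/
def TwoEnds (C : ShadedTubes n δ) (ε₁ C₁ : ℝ) : Prop :=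
  ∀ l ∈ C.tubes, ∀ r : ℝ, δ ≤ r → r ≤ 1 → ∀ x : E n,
    (((C.Y l).filter fun k => cube n δ k ⊆ Metric.closedBall x r).card : ℝ)
      ≤ r ^ ε₁ * C₁ * C.density * δ⁻¹

open Classical in
/-- `(ε₂, C₂)`-robust transversality, at all angles `δ ≤ r ≤ 1`. -/
def RobustlyTransverse (C : ShadedTubes n δ) (ε₂ C₂ : ℝ) : Prop :=
  ∀ k : Fin n → ℤ, ∀ v : E n, ∀ r : ℝ, δ ≤ r → r ≤ 1 →
    (((C.through k).filter fun l => InnerProductGeometry.angle l.dir v ≤ r).card : ℝ)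
      ≤ r ^ ε₂ * C₂ * C.multiplicity

end ShadedTubes

/-- `M(s, t, δ)`, the infimum of the volumes of the unions of the shadings. -/
noncomputable def M (n : ℕ) (s t δ : ℝ) : ℝ :=
  sInf {m | ∃ C : ShadedTubes n δ, C.Admissible s t ∧ m = volume.real C.union}

/-- `N(s, t)`, the upper limit of `log M(s, t, δ) / log δ` as `δ → 0⁺`. -/
noncomputable def N (n : ℕ) (s t : ℝ) : ℝ :=
  limsup (fun δ : ℝ => Real.log (M n s t δ) / Real.log δ) (𝓝[>] 0)

/-- `σₙ`, the infimum of `N(s, t)` over `(s, t) ∈ (0, 1)²`. -/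
noncomputable def sigma (n : ℕ) : ℝ :=
  sInf {a | ∃ s ∈ Set.Ioo (0 : ℝ) 1, ∃ t ∈ Set.Ioo (0 : ℝ) 1, a = N n s t}

/-- The pair `(𝕋, Y)_δ` is `η`-extremal. -/
structure ShadedTubes.IsExtremal {n : ℕ} {δ : ℝ} (C : ShadedTubes n δ) (η : ℝ) : Prop where
  admissible : C.Admissible η η
  volume_le : volume.real C.union ≤ δ ^ (sigma n - η)

end StickyKakeya

/-!
The multiplicity of an extremal collection is at least about `δ^(-σ)`, because its mass is at least
`δ^η` while the union of its shadings has volume at most `δ^(σ - η)`. Robust transversality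
therefore follows from the bound `≲ (r / δ)^σ`, up to small powers of `δ`, for the number of tubes
through a cube whose directions lie in a cone of aperture `r`.

These tubes lie in few of the `ρ`-tubes of a sticky cover at a scale `ρ ≈ r`. The tubes inside one
`ρ`-tube, rescaled by a shear and a dilation, form a sticky collection of `δ / ρ`-tubes. Consider
the heavy cubes, those contained in the shadings of at least `K = δ^(-ε) (δ / ρ)^(-σ)` of these
tubes. If the heavy cubes had large mass, then the rescaled heavy shading would be admissible at scale
`δ / ρ`, and by the definition of `σ` (`exists_rpow_le_volume_union`) its union would have volume at
least about `(δ / ρ)^σ`. Since all the cubes of that union have multiplicity at least `K`, double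
counting bounds its volume by `≲ δ^(-η) / K`, which is smaller
(`ShadedTubes.sum_card_heavy_le`). So the heavy cubes have negligible mass, and they can be removed
at the finitely many scales `ρ = δ^(j / m)` with `j < m` (`ShadedTubes.exists_pruned`). Angles
`r ≤ δ^(1 - 1 / m)` need no removal: at most `≲ δ^(-η) (r / δ)³` tubes of the whole collection have
directions in such a cone. This is the refinement of `ShadedTubes.IsExtremal.exists_refinement`.

The two-ends condition with exponent `1` holds for every collection of large mass, as a ball of
radius `r` meets a tube in at most `≲ r / δ` cubes, and the density is at least about `δ^(3η)`.

Volumes are handled by counting indices of cubes. In particular a rescaled shading consists of the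
cubes of side `δ / ρ` that contain the image of the corner of a cube of the original shading; cubes
of side `δ` are not mapped to cubes, but the multiplicity of a heavy cube passes to the cube that
contains the image of its corner. The numerical constants are not optimized.
-/

namespace StickyKakeya

open InnerProductGeometry

/-! ### Angles, slopes and norms -/

section Angle

variable {V : Type*} [NormedAddCommGroup V] [InnerProductSpace ℝ V]

theorem norm_sub_sq_eq_of_norm_eq_one {u v : V} (hu : ‖u‖ = 1) (hv : ‖v‖ = 1) :
    ‖u - v‖ ^ 2 = 2 - 2 * Real.cos (angle u v) := by
  rw [norm_sub_sq_real, ← inner_eq_cos_angle_of_norm_eq_one hu hv, hu, hv]; ring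

theorem norm_sub_le_angle {u v : V} (hu : ‖u‖ = 1) (hv : ‖v‖ = 1) : ‖u - v‖ ≤ angle u v := by
  refine le_of_sq_le_sq ?_ (angle_nonneg u v)
  rw [norm_sub_sq_eq_of_norm_eq_one hu hv]
  have := Real.one_sub_sq_div_two_le_cos (x := angle u v)
  linarith

theorem angle_le_two_mul_norm_sub {u v : V} (hu : ‖u‖ = 1) (hv : ‖v‖ = 1) :
    angle u v ≤ 2 * ‖u - v‖ := by
  refine le_of_sq_le_sq ?_ (by positivity)
  rw [mul_pow, norm_sub_sq_eq_of_norm_eq_one hu hv]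
  have h := Real.cos_le_one_sub_mul_cos_sq (x := angle u v)
    (by rw [abs_of_nonneg (angle_nonneg u v)]; exact angle_le_pi u v)
  have h2 : (1 : ℝ) / 8 ≤ 2 / Real.pi ^ 2 := by
    rw [div_le_div_iff₀ (by norm_num) (by positivity)]
    nlinarith [Real.pi_le_four, Real.pi_pos]
  nlinarith [sq_nonneg (angle u v)]

end Angle

namespace Line

theorem half_le_dir_last (l : Line 4) : 1 / 2 ≤ l.dir 3 := l.dir_last 3 rfl

theorem dir_last_pos (l : Line 4) : 0 < l.dir 3 := by linarith [l.half_le_dir_last]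

theorem abs_dir_le (l : Line 4) (i : Fin 4) : |l.dir i| ≤ 1 := by
  simpa [l.dir_norm] using PiLp.norm_apply_le l.dir i

/-- The direction of a line, rescaled to have last coordinate `1`. -/
noncomputable def slope (l : Line 4) : E 4 := (l.dir 3)⁻¹ • l.dir

theorem slope_last (l : Line 4) : l.slope 3 = 1 := by
  simp [slope, l.dir_last_pos.ne']

theorem dir_eq_smul_slope (l : Line 4) : l.dir = l.dir 3 • l.slope := by
  rw [slope, smul_smul, mul_inv_cancel₀ l.dir_last_pos.ne', one_smul]

theorem norm_slope (l : Line 4) : ‖l.slope‖ = (l.dir 3)⁻¹ := by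
  rw [slope, norm_smul, l.dir_norm, mul_one, Real.norm_eq_abs,
    abs_of_pos (inv_pos.2 l.dir_last_pos)]

theorem norm_slope_le (l : Line 4) : ‖l.slope‖ ≤ 2 := by
  rw [norm_slope]
  exact (inv_anti₀ (by norm_num) l.half_le_dir_last).trans (by norm_num)

theorem norm_slope_sub_le (l l' : Line 4) : ‖l.slope - l'.slope‖ ≤ 6 * ‖l.dir - l'.dir‖ := by
  have ha := l.dir_last_pos
  have hd : |l'.dir 3 - l.dir 3| ≤ ‖l.dir - l'.dir‖ := by
    rw [abs_sub_comm]; simpa using PiLp.norm_apply_le (l.dir - l'.dir) 3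
  have hi : (l.dir 3)⁻¹ ≤ 2 := by
    exact (inv_anti₀ (by norm_num) l.half_le_dir_last).trans (by norm_num)
  have e : l.slope - l'.slope =
      (l.dir 3)⁻¹ • ((l.dir - l'.dir) + (l'.dir 3 - l.dir 3) • l'.slope) := by
    rw [smul_add, smul_sub, sub_smul, ← dir_eq_smul_slope, smul_sub, smul_smul,
      inv_mul_cancel₀ ha.ne', one_smul, slope]
    abel
  rw [e, norm_smul, Real.norm_eq_abs, abs_of_pos (inv_pos.2 ha)]
  have h2 : ‖(l.dir - l'.dir) + (l'.dir 3 - l.dir 3) • l'.slope‖ ≤ 3 * ‖l.dir - l'.dir‖ := by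
    refine (norm_add_le _ _).trans ?_
    rw [norm_smul, Real.norm_eq_abs]
    nlinarith [l'.norm_slope_le, norm_nonneg l'.slope, norm_nonneg (l.dir - l'.dir),
      abs_nonneg (l'.dir 3 - l.dir 3)]
  calc (l.dir 3)⁻¹ * _ ≤ 2 * (3 * ‖l.dir - l'.dir‖) := by gcongr
    _ = _ := by ring

theorem norm_dir_sub_le (l l' : Line 4) : ‖l.dir - l'.dir‖ ≤ 2 * ‖l.slope - l'.slope‖ := by
  have ha := l.dir_last_pos
  have ha' := l'.dir_last_pos
  have h1 : l.dir 3 ≤ 1 := (le_abs_self _).trans (l.abs_dir_le 3)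
  have e : l.dir - l'.dir = l.dir 3 • (l.slope - l'.slope) + (l.dir 3 - l'.dir 3) • l'.slope := by
    rw [smul_sub, sub_smul, ← dir_eq_smul_slope, ← dir_eq_smul_slope]; abel
  have hn : |l.dir 3 - l'.dir 3| * ‖l'.slope‖ ≤ ‖l.slope - l'.slope‖ := by
    have h := abs_norm_sub_norm_le l.slope l'.slope
    rw [norm_slope, norm_slope] at h
    rw [norm_slope]
    have e2 : (l.dir 3)⁻¹ - (l'.dir 3)⁻¹ =
        -((l.dir 3 - l'.dir 3) * (l'.dir 3)⁻¹ * (l.dir 3)⁻¹) := by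
      field_simp; ring
    rw [e2, abs_neg, abs_mul, abs_mul, abs_of_pos (inv_pos.2 ha), abs_of_pos (inv_pos.2 ha')] at h
    refine le_trans ?_ h
    exact le_mul_of_one_le_right (by positivity) (one_le_inv₀ ha |>.2 h1)
  rw [e]
  refine (norm_add_le _ _).trans ?_
  rw [norm_smul, norm_smul, Real.norm_eq_abs, Real.norm_eq_abs, abs_of_pos ha]
  nlinarith [norm_nonneg (l.slope - l'.slope)]

theorem norm_dir_sub_le_angle (l l' : Line 4) : ‖l.dir - l'.dir‖ ≤ angle l.dir l'.dir :=
  norm_sub_le_angle l.dir_norm l'.dir_norm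

theorem angle_le (l l' : Line 4) : angle l.dir l'.dir ≤ 2 * ‖l.dir - l'.dir‖ :=
  angle_le_two_mul_norm_sub l.dir_norm l'.dir_norm

theorem d_comm {n : ℕ} (l l' : Line n) : l.d l' = l'.d l := by
  rw [d, d, norm_sub_rev, angle_comm]

theorem d_triangle {n : ℕ} (l l' l'' : Line n) : l.d l'' ≤ l.d l' + l'.d l'' := by
  have h1 := norm_sub_le_norm_sub_add_norm_sub l.base l'.base l''.base
  have h2 := angle_le_angle_add_angle l.dir l'.dir l''.dir
  simp only [d]; linarith

theorem norm_base_sub_le_d {n : ℕ} (l l' : Line n) : ‖l.base - l'.base‖ ≤ l.d l' :=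
  le_add_of_nonneg_right (angle_nonneg _ _)

theorem angle_le_d {n : ℕ} (l l' : Line n) : angle l.dir l'.dir ≤ l.d l' :=
  le_add_of_nonneg_left (norm_nonneg _)

end Line

/-! ### Counting directions and cubes -/

theorem card_Icc_floor_le {x y : ℝ} (h : x ≤ y) :
    ((Finset.Icc ⌊x⌋ ⌊y⌋).card : ℝ) ≤ y - x + 2 := by
  have h1 : ⌊x⌋ ≤ ⌊y⌋ := Int.floor_mono h
  have h2 : ((Finset.Icc ⌊x⌋ ⌊y⌋).card : ℤ) = ⌊y⌋ + 1 - ⌊x⌋ := by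
    rw [Int.card_Icc, Int.toNat_of_nonneg (by omega)]
  have h3 : ((Finset.Icc ⌊x⌋ ⌊y⌋).card : ℝ) = ⌊y⌋ + 1 - ⌊x⌋ := by exact_mod_cast h2
  rw [h3]
  linarith [Int.floor_le y, Int.lt_floor_add_one x]

theorem card_Icc_ceil_le {x y : ℝ} (h : 0 ≤ y - x + 1) :
    ((Finset.Icc ⌈x⌉ ⌊y⌋).card : ℝ) ≤ y - x + 1 := by
  rcases le_total 0 (⌊y⌋ + 1 - ⌈x⌉) with h1 | h1
  · have h2 : ((Finset.Icc ⌈x⌉ ⌊y⌋).card : ℤ) = ⌊y⌋ + 1 - ⌈x⌉ := by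
      rw [Int.card_Icc, Int.toNat_of_nonneg h1]
    have h3 : ((Finset.Icc ⌈x⌉ ⌊y⌋).card : ℝ) = ⌊y⌋ + 1 - ⌈x⌉ := by exact_mod_cast h2
    rw [h3]
    linarith [Int.floor_le y, Int.le_ceil x]
  · rw [Int.card_Icc, Int.toNat_of_nonpos h1]
    simpa using h

theorem angle_le_of_abs_sub_le (l l' : Line 4) {h : ℝ}
    (hh : ∀ i : Fin 3, |l.dir i.castSucc - l'.dir i.castSucc| ≤ h) :
    angle l.dir l'.dir ≤ 14 * h := by
  have h0 : |l.dir 0 - l'.dir 0| ≤ h := hh 0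
  have h1 : |l.dir 1 - l'.dir 1| ≤ h := hh 1
  have h2 : |l.dir 2 - l'.dir 2| ≤ h := hh 2
  have hpos : 0 ≤ h := (abs_nonneg _).trans h0
  have n1 : l.dir 0 ^ 2 + l.dir 1 ^ 2 + l.dir 2 ^ 2 + l.dir 3 ^ 2 = 1 := by
    have := EuclideanSpace.norm_sq_eq l.dir
    simpa [Fin.sum_univ_four, l.dir_norm] using this.symm
  have n2 : l'.dir 0 ^ 2 + l'.dir 1 ^ 2 + l'.dir 2 ^ 2 + l'.dir 3 ^ 2 = 1 := by
    have := EuclideanSpace.norm_sq_eq l'.dir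
    simpa [Fin.sum_univ_four, l'.dir_norm] using this.symm
  have key : ∀ i, |l.dir i - l'.dir i| ≤ h → |l.dir i ^ 2 - l'.dir i ^ 2| ≤ 2 * h := by
    intro i hi
    rw [sq_sub_sq, abs_mul, mul_comm]
    have : |l.dir i + l'.dir i| ≤ 2 :=
      (abs_add_le _ _).trans (by linarith [l.abs_dir_le i, l'.abs_dir_le i])
    calc _ ≤ h * 2 := by gcongr
      _ = _ := by ring
  have h3 : |l.dir 3 - l'.dir 3| ≤ 6 * h := by
    have e : (l.dir 3 - l'.dir 3) * (l.dir 3 + l'.dir 3) =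
        -((l.dir 0 ^ 2 - l'.dir 0 ^ 2) + (l.dir 1 ^ 2 - l'.dir 1 ^ 2)
          + (l.dir 2 ^ 2 - l'.dir 2 ^ 2)) := by linarith
    have e2 : |l.dir 3 - l'.dir 3| * (l.dir 3 + l'.dir 3) ≤ 6 * h := by
      rw [← abs_of_nonneg (show 0 ≤ l.dir 3 + l'.dir 3 by
        linarith [l.dir_last_pos, l'.dir_last_pos]), ← abs_mul, e, abs_neg]
      refine (abs_add_three _ _ _).trans ?_
      linarith [key 0 h0, key 1 h1, key 2 h2]
    nlinarith [abs_nonneg (l.dir 3 - l'.dir 3), l.half_le_dir_last, l'.half_le_dir_last]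
  refine (l.angle_le l').trans ?_
  have : ‖l.dir - l'.dir‖ ≤ 7 * h := by
    refine le_of_sq_le_sq ?_ (by positivity)
    rw [EuclideanSpace.norm_sq_eq, Fin.sum_univ_four]
    simp only [PiLp.sub_apply, Real.norm_eq_abs]
    have := pow_le_pow_left₀ (abs_nonneg _) h0 2
    have := pow_le_pow_left₀ (abs_nonneg _) h1 2
    have := pow_le_pow_left₀ (abs_nonneg _) h2 2
    have := pow_le_pow_left₀ (abs_nonneg _) h3 2
    nlinarith
  linarith

open Classical in
/-- If each direction of `U` is `ρ`-parallel to at most `B` directions of `U`, then at most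
`≲ (R / ρ)³ B` of the lines of `U` have directions in a given ball of radius `R`: the directions are
parametrized by their first three coordinates, which are put into boxes of side `ρ / 16`. -/
theorem card_le_of_parallel_le {U W : Finset (Line 4)} {ρ B R : ℝ} (hρ : 0 < ρ) (hR : 0 ≤ R)
    (hB : 0 ≤ B) (hU : ∀ u ∈ U, ((U.filter fun u' => angle u'.dir u.dir ≤ ρ).card : ℝ) ≤ B)
    (hW : W ⊆ U) (a : E 4) (ha : ∀ u ∈ W, ‖u.dir - a‖ ≤ R) :
    (W.card : ℝ) ≤ (32 * R / ρ + 2) ^ 3 * B := by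
  let f : Line 4 → (Fin 3 → ℤ) := fun u i => ⌊u.dir i.castSucc / (ρ / 16)⌋
  let box : Finset (Fin 3 → ℤ) := Fintype.piFinset fun i =>
    Finset.Icc ⌊(a i.castSucc - R) / (ρ / 16)⌋ ⌊(a i.castSucc + R) / (ρ / 16)⌋
  have hbox : (box.card : ℝ) ≤ (32 * R / ρ + 2) ^ 3 := by
    rw [Fintype.card_piFinset, Nat.cast_prod]
    refine (Finset.prod_le_prod (fun _ _ => by positivity) fun i _ =>
      card_Icc_floor_le (by gcongr; linarith)).trans (le_of_eq ?_)
    rw [Finset.prod_congr rfl (g := fun _ => 32 * R / ρ + 2)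
      (fun i _ => by field_simp; ring)]
    simp
  have hmaps : ∀ u ∈ W, f u ∈ box := by
    intro u hu
    rw [Fintype.mem_piFinset]
    intro i
    have : |u.dir i.castSucc - a i.castSucc| ≤ R :=
      le_trans (by simpa using PiLp.norm_apply_le (u.dir - a) i.castSucc) (ha u hu)
    rw [abs_le] at this
    rw [Finset.mem_Icc]
    exact ⟨Int.floor_mono (by gcongr; linarith), Int.floor_mono (by gcongr; linarith)⟩
  have hfib : ∀ b ∈ box, (W.filter fun u => f u = b).card ≤ ⌊B⌋₊ := by
    intro b _
    refine Nat.le_floor ?_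
    rcases (W.filter fun u => f u = b).eq_empty_or_nonempty with h | ⟨u, hu⟩
    · rw [h]; simpa using hB
    refine le_trans ?_ (hU u (hW (Finset.mem_filter.1 hu).1))
    norm_cast
    refine Finset.card_le_card fun u' hu' => ?_
    rw [Finset.mem_filter] at hu hu' ⊢
    refine ⟨hW hu'.1, (angle_le_of_abs_sub_le u' u (h := ρ / 16) fun i => ?_).trans (by linarith)⟩
    have : f u' i = f u i := by rw [hu.2, hu'.2]
    have h1 := Int.abs_sub_lt_one_of_floor_eq_floor this
    rw [← sub_div, abs_div, abs_of_pos (show 0 < ρ / 16 by positivity),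
      div_lt_one (by positivity)] at h1
    exact h1.le
  have h := Finset.card_le_mul_card_image_of_maps_to hmaps _ hfib
  calc (W.card : ℝ) ≤ ⌊B⌋₊ * box.card := by exact_mod_cast h
    _ ≤ B * (32 * R / ρ + 2) ^ 3 := by
        gcongr
        exact Nat.floor_le hB
    _ = _ := mul_comm _ _

/-- A set of points of `(δ ℤ)⁴` that are close to the point of `p + ℝ w` with parameter equal to
their last coordinate, and whose last coordinates lie in an interval of length `L`, is counted by its
`≲ L / δ + 1` horizontal slices. -/
theorem card_le_of_near_line (p w : E 4) {δ L a : ℝ} (hδ : 0 < δ) (hL : 0 ≤ L) (B : ℕ)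
    (s : Finset (Fin 4 → ℤ))
    (hs : ∀ k ∈ s, ∀ i, |δ * k i - p i - δ * k 3 * w i| ≤ B * δ)
    (ha : ∀ k ∈ s, a ≤ δ * k 3 ∧ δ * k 3 ≤ a + L) :
    (s.card : ℝ) ≤ (2 * B + 1) ^ 3 * (L / δ + 1) := by
  have hmaps : ∀ k ∈ s, k 3 ∈ Finset.Icc ⌈a / δ⌉ ⌊(a + L) / δ⌋ := by
    intro k hk
    rw [Finset.mem_Icc, Int.ceil_le, Int.le_floor, div_le_iff₀ hδ, le_div_iff₀ hδ, mul_comm]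
    exact ha k hk
  have hfib : ∀ m ∈ Finset.Icc ⌈a / δ⌉ ⌊(a + L) / δ⌋,
      (s.filter fun k => k 3 = m).card ≤ (2 * B + 1) ^ 3 := by
    intro m _
    let x : Fin 3 → ℝ := fun i => (p i.castSucc + δ * m * w i.castSucc) / δ
    have hsub : (s.filter fun k => k 3 = m).card ≤
        (Fintype.piFinset fun i : Fin 3 => Finset.Icc (⌈x i⌉ - B) (⌊x i⌋ + B)).card := by
      refine Finset.card_le_card_of_injOn (fun k i => k i.castSucc) ?_ ?_
      · intro k hk
        rw [Finset.mem_coe, Finset.mem_filter] at hk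
        rw [Finset.mem_coe, Fintype.mem_piFinset]
        intro i
        have h := hs k hk.1 i.castSucc
        rw [hk.2] at h
        have e : δ * k i.castSucc - p i.castSucc - δ * m * w i.castSucc =
            δ * (k i.castSucc - x i) := by
          simp only [x]; field_simp; ring
        rw [e, abs_mul, abs_of_pos hδ, mul_comm, mul_le_mul_iff_left₀ hδ, abs_le] at h
        rw [Finset.mem_Icc, sub_le_iff_le_add, Int.ceil_le, ← sub_le_iff_le_add, Int.le_floor]
        push_cast
        constructor <;> linarith
      · intro k hk k' hk' h
        rw [Finset.mem_coe, Finset.mem_filter] at hk hk'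
        funext i
        refine Fin.lastCases ?_ (fun j => congrFun h j) i
        exact hk.2.trans hk'.2.symm
    refine hsub.trans ?_
    rw [Fintype.card_piFinset]
    refine (Finset.prod_le_pow_card _ _ (2 * B + 1) fun i _ => ?_).trans (by simp)
    rw [Int.card_Icc]
    have := Int.floor_le_ceil (x i)
    omega
  have h := Finset.card_le_mul_card_image_of_maps_to hmaps _ hfib
  have e : (a + L) / δ - a / δ = L / δ := by ring
  have h2 := card_Icc_ceil_le (x := a / δ) (y := (a + L) / δ) (by rw [e]; positivity)
  rw [e] at h2
  calc (s.card : ℝ) ≤ (2 * B + 1) ^ 3 * (Finset.Icc ⌈a / δ⌉ ⌊(a + L) / δ⌋).card := by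
        exact_mod_cast h
    _ ≤ _ := by gcongr

/-! ### Volumes of cubes, shadings and tubes -/

variable {n : ℕ} {δ : ℝ}

theorem measurableSet_cube (k : Fin n → ℤ) : MeasurableSet (cube n δ k) := by
  have : cube n δ k = ⋂ i, (fun x : E n => x i) ⁻¹' Set.Ico (δ * k i) (δ * k i + δ) := by
    ext x; simp [cube]
  rw [this]
  exact MeasurableSet.iInter fun i =>
    (EuclideanSpace.proj (𝕜 := ℝ) i).continuous.measurable measurableSet_Ico

theorem volume_real_cube (hδ : 0 < δ) (k : Fin n → ℤ) : volume.real (cube n δ k) = δ ^ n := by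
  have h : cube n δ k = WithLp.ofLp ⁻¹'
      (Set.univ.pi fun i => Set.Ico (δ * k i) (δ * k i + δ)) := by
    ext x; simp [cube]
  rw [h, Measure.real, (PiLp.volume_preserving_ofLp (Fin n)).measure_preimage
    (MeasurableSet.univ_pi fun _ => measurableSet_Ico).nullMeasurableSet,
    Real.volume_pi_Ico_toReal (fun i => by simp [hδ.le])]
  simp

theorem volume_cube_ne_top (hδ : 0 < δ) (k : Fin n → ℤ) : volume (cube n δ k) ≠ ⊤ := by
  intro h
  have := volume_real_cube hδ k
  rw [Measure.real, h, ENNReal.toReal_top] at this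
  exact (pow_pos hδ n).ne this

/-- The index of the `δ`-cube that contains `x`. -/
noncomputable def cubeIndex (δ : ℝ) (x : E n) : Fin n → ℤ := fun i => ⌊x i / δ⌋

theorem mem_cube_iff (hδ : 0 < δ) {x : E n} {k : Fin n → ℤ} :
    x ∈ cube n δ k ↔ cubeIndex δ x = k := by
  simp only [cube, Set.mem_ofPred_eq, Set.mem_Ico, cubeIndex, funext_iff, Int.floor_eq_iff,
    le_div_iff₀ hδ, div_lt_iff₀ hδ]
  refine forall_congr' fun i => ?_
  rw [add_mul, one_mul, mul_comm]

theorem volume_real_biUnion_cube (hδ : 0 < δ) (s : Finset (Fin n → ℤ)) :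
    volume.real (⋃ k ∈ s, cube n δ k) = s.card * δ ^ n := by
  rw [measureReal_biUnion_finset ?_ (fun k _ => measurableSet_cube k)
    (fun k _ => volume_cube_ne_top hδ k)]
  · simp [volume_real_cube hδ]
  · intro k _ k' _ hkk
    refine Set.disjoint_left.2 fun x hx hx' => hkk ?_
    rw [mem_cube_iff hδ] at hx hx'
    exact hx.symm.trans hx'

theorem volume_biUnion_cube_ne_top (hδ : 0 < δ) (s : Finset (Fin n → ℤ)) :
    volume (⋃ k ∈ s, cube n δ k) ≠ ⊤ := by
  exact (measure_biUnion_lt_top s.finite_toSet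
    fun k _ => (volume_cube_ne_top hδ k).lt_top).ne

namespace ShadedTubes

theorem volume_real_shading (hδ : 0 < δ) (C : ShadedTubes n δ) (l : Line n) :
    volume.real (C.shading l) = (C.Y l).card * δ ^ n := volume_real_biUnion_cube hδ _

theorem mass_eq (hδ : 0 < δ) (C : ShadedTubes n δ) :
    C.mass = (∑ l ∈ C.tubes, ((C.Y l).card : ℝ)) * δ ^ n := by
  simp only [mass, volume_real_shading hδ, Finset.sum_mul]

theorem union_eq (C : ShadedTubes n δ) : C.union = ⋃ k ∈ C.cubes, cube n δ k := by
  simp only [union, shading, cubes, Finset.mem_biUnion]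
  ext x; simp only [Set.mem_iUnion]
  aesop

theorem volume_real_union (hδ : 0 < δ) (C : ShadedTubes n δ) :
    volume.real C.union = C.cubes.card * δ ^ n := by
  rw [union_eq, volume_real_biUnion_cube hδ]

theorem sum_card_through (C : ShadedTubes n δ) :
    ∑ k ∈ C.cubes, ((C.through k).card : ℝ) = ∑ l ∈ C.tubes, ((C.Y l).card : ℝ) := by
  classical
  have h := Finset.sum_card_bipartiteAbove_eq_sum_card_bipartiteBelow (s := C.tubes) (t := C.cubes)
    (fun l k => k ∈ C.Y l)
  have e : ∀ l ∈ C.tubes, (Finset.bipartiteAbove (fun l k => k ∈ C.Y l) C.cubes l) = C.Y l := by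
    intro l hl
    ext k
    simp only [Finset.bipartiteAbove, Finset.mem_filter, cubes, Finset.mem_biUnion]
    exact ⟨fun h => h.2, fun h => ⟨⟨l, hl, h⟩, h⟩⟩
  rw [Finset.sum_congr rfl fun l hl => congrArg Finset.card (e l hl)] at h
  exact_mod_cast h.symm

/-- The average multiplicity is the ratio of the mass and the volume of the union. -/
theorem multiplicity_eq (hδ : 0 < δ) (C : ShadedTubes n δ) :
    C.multiplicity = C.mass / volume.real C.union := by
  rw [multiplicity, sum_card_through, mass_eq hδ, volume_real_union hδ,
    mul_div_mul_right _ _ (by positivity)]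

theorem union_pos_of_mass_pos (hδ : 0 < δ) (C : ShadedTubes n δ) (h : 0 < C.mass) :
    δ ^ n ≤ volume.real C.union := by
  have hne : C.cubes.Nonempty := by
    rw [Finset.nonempty_iff_ne_empty]
    intro he
    have := C.sum_card_through
    rw [mass_eq hδ, ← this, he] at h
    simp at h
  rw [volume_real_union hδ]
  refine le_mul_of_one_le_left (by positivity) ?_
  exact_mod_cast hne.card_pos

end ShadedTubes

/-- The points of a tube lie near the graph of its axis over the last coordinate. -/
theorem Line.abs_sub_le_of_mem_tube (l : Line 4) {x : E 4} (hx : x ∈ l.tube δ) (i : Fin 4) :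
    |x i - l.base i - x 3 * l.slope i| ≤ 24 * δ := by
  obtain ⟨y, ⟨a, rfl⟩, hy⟩ := Metric.mem_thickening_iff.1 hx.1
  rw [dist_eq_norm] at hy
  set z := x - (l.base + a • l.dir) with hz
  have h3 := PiLp.norm_apply_le z 3
  have hi := PiLp.norm_apply_le z i
  have hw := (PiLp.norm_apply_le l.slope i).trans l.norm_slope_le
  have ev : l.dir i = l.dir 3 * l.slope i := by
    conv_lhs => rw [l.dir_eq_smul_slope]
    simp
  have e : x i - l.base i - x 3 * l.slope i = z i - z 3 * l.slope i := by
    simp only [hz, PiLp.sub_apply, PiLp.add_apply, PiLp.smul_apply, smul_eq_mul, ev,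
      l.base_last 3 rfl]
    ring
  rw [e]
  refine (abs_sub _ _).trans ?_
  rw [abs_mul]
  rw [Real.norm_eq_abs] at h3 hi hw
  push_cast at hy
  nlinarith [abs_nonneg (z 3), abs_nonneg (l.slope i)]

theorem cube_corner_mem (hδ : 0 < δ) (k : Fin n → ℤ) :
    (WithLp.toLp 2 fun i => δ * (k i : ℝ)) ∈ cube n δ k := by
  intro i; simp [hδ]

theorem Line.abs_corner_sub_le (l : Line 4) (hδ : 0 < δ) {k : Fin 4 → ℤ}
    (h : cube 4 δ k ⊆ l.tube δ) (i : Fin 4) :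
    |δ * k i - l.base i - δ * k 3 * l.slope i| ≤ 24 * δ :=
  l.abs_sub_le_of_mem_tube (h (cube_corner_mem hδ k)) i

/-- A family of `δ`-cubes in a `δ`-tube over an interval of length `L` of the last coordinate. -/
theorem Line.card_cubes_le (l : Line 4) (hδ : 0 < δ) {L a : ℝ} (hL : 0 ≤ L)
    (s : Finset (Fin 4 → ℤ)) (hs : ∀ k ∈ s, cube 4 δ k ⊆ l.tube δ)
    (ha : ∀ k ∈ s, a ≤ δ * k 3 ∧ δ * k 3 ≤ a + L) :
    (s.card : ℝ) ≤ 117649 * (L / δ + 1) := by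
  have := card_le_of_near_line l.base l.slope hδ hL 24 s
    (fun k hk i => by simpa using l.abs_corner_sub_le hδ (hs k hk) i) ha
  norm_num at this ⊢
  exact this

/-- A `δ`-tube has volume `≲ δ³`, being covered by `≲ 1 / δ` cubes of side `δ`. -/
theorem Line.volume_real_tube_le (l : Line 4) (hδ : 0 < δ) (hδ1 : δ ≤ 1) :
    volume (l.tube δ) ≠ ⊤ ∧ volume.real (l.tube δ) ≤ 1000000 * δ ^ 3 := by
  let G : Finset (Fin 4 → ℤ) :=
    (Fintype.piFinset fun _ => Finset.Icc ⌊(-1) / δ⌋ ⌊1 / δ⌋).filter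
      fun k => ∀ i, |δ * k i - l.base i - δ * k 3 * l.slope i| ≤ (27 : ℕ) * δ
  have hcov : l.tube δ ⊆ ⋃ k ∈ G, cube 4 δ k := by
    intro x hx
    simp only [Set.mem_iUnion]
    refine ⟨cubeIndex δ x, ?_, (mem_cube_iff hδ).2 rfl⟩
    have hfl : ∀ i, |δ * cubeIndex δ x i - x i| ≤ δ := by
      intro i
      have h := (mem_cube_iff hδ).2 (rfl : cubeIndex δ x = _) i
      rw [Set.mem_Ico] at h
      rw [abs_le]; constructor <;> linarith
    rw [Finset.mem_filter, Fintype.mem_piFinset]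
    refine ⟨fun i => ?_, fun i => ?_⟩
    · have := hx.2 i
      rw [Finset.mem_Icc]
      exact ⟨Int.floor_mono (by gcongr; exact this.1), Int.floor_mono (by gcongr; exact this.2)⟩
    · have h1 := l.abs_sub_le_of_mem_tube hx i
      have hw := (PiLp.norm_apply_le l.slope i).trans l.norm_slope_le
      rw [Real.norm_eq_abs] at hw
      have e : δ * cubeIndex δ x i - l.base i - δ * cubeIndex δ x 3 * l.slope i =
          (δ * cubeIndex δ x i - x i) + (x i - l.base i - x 3 * l.slope i)
            - (δ * cubeIndex δ x 3 - x 3) * l.slope i := by ring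
      have h2 : |(δ * cubeIndex δ x 3 - x 3) * l.slope i| ≤ δ * 2 := by
        rw [abs_mul]
        exact mul_le_mul (hfl 3) hw (abs_nonneg _) hδ.le
      rw [e]
      refine (abs_sub _ _).trans ?_
      have := abs_add_le (δ * cubeIndex δ x i - x i) (x i - l.base i - x 3 * l.slope i)
      have := hfl i
      push_cast
      linarith
  have hcard : (G.card : ℝ) ≤ (2 * (27 : ℕ) + 1) ^ 3 * (3 / δ + 1) := by
    refine card_le_of_near_line l.base l.slope (a := -2) hδ (by norm_num) 27 G
      (fun k hk => (Finset.mem_filter.1 hk).2) fun k hk => ?_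
    have h := Fintype.mem_piFinset.1 (Finset.mem_filter.1 hk).1 3
    rw [Finset.mem_Icc, Int.le_floor, le_div_iff₀ hδ] at h
    have h2 : (-1) / δ - 1 < (k 3 : ℝ) := (Int.sub_one_lt_floor _).trans_le (by exact_mod_cast h.1)
    rw [sub_lt_iff_lt_add, div_lt_iff₀ hδ] at h2
    constructor <;> linarith
  have htop := volume_biUnion_cube_ne_top hδ G
  refine ⟨ne_top_of_le_ne_top htop (measure_mono hcov), (measureReal_mono hcov htop).trans ?_⟩
  rw [volume_real_biUnion_cube hδ]
  have h2 : (G.card : ℝ) ≤ 1000000 / δ := by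
    refine hcard.trans ?_
    rw [div_add_one hδ.ne', ← mul_div_assoc]
    gcongr
    norm_num
    linarith
  calc (G.card : ℝ) * δ ^ 4 ≤ 1000000 / δ * δ ^ 4 := by gcongr
    _ = _ := by field_simp

/-! ### Counting tubes of a sticky collection -/

open Classical in
/-- A sticky collection of essentially distinct `δ`-tubes has at most `≲ (R / δ)³ δ^(-t)` tubes
whose directions lie in a given ball of radius `R ≥ δ`: a `δ`-tube of the cover at scale `δ` covers
at most one of them. -/
theorem ShadedTubes.card_le_of_norm_dir_sub_le (C : ShadedTubes 4 δ) {t R : ℝ} (hδ : 0 < δ)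
    (hδ1 : δ ≤ 1) (hd : C.EssentiallyDistinct) (hs : C.StickyCovered t) (hR : δ ≤ R)
    {W : Finset (Line 4)} (hW : W ⊆ C.tubes) (a : E 4) (ha : ∀ l ∈ W, ‖l.dir - a‖ ≤ R) :
    (W.card : ℝ) ≤ 300000 * (R / δ) ^ 3 * δ ^ (-t) := by
  obtain ⟨U, hcov, hU⟩ := hs δ le_rfl hδ1
  choose! f hfU hf using hcov
  have hinj : Set.InjOn f W := by
    intro l hl l' hl' hll
    by_contra hne
    have h1 := hd l (hW hl) l' (hW hl') hne
    have h2 := l.d_triangle (f l) l'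
    have h3 := hf l (hW hl)
    have h4 := hf l' (hW hl')
    rw [← hll, Line.d_comm] at h4
    linarith
  rw [← Finset.card_image_of_injOn hinj]
  refine (card_le_of_parallel_le (R := 2 * R) hδ (by linarith) (by positivity) hU ?_ a ?_).trans ?_
  · intro u hu
    obtain ⟨l, hl, rfl⟩ := Finset.mem_image.1 hu
    exact hfU l (hW hl)
  · intro u hu
    obtain ⟨l, hl, rfl⟩ := Finset.mem_image.1 hu
    have h1 := norm_sub_le_norm_sub_add_norm_sub (f l).dir l.dir a
    have h2 := (f l).norm_dir_sub_le_angle l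
    have h3 := (f l).angle_le_d l
    rw [(f l).d_comm] at h3
    linarith [hf l (hW hl), ha l hl]
  · gcongr
    have h1 : 1 ≤ R / δ := (one_le_div hδ).2 hR
    calc (32 * (2 * R) / δ + 2) ^ 3 ≤ (66 * (R / δ)) ^ 3 := by
          have e : 32 * (2 * R) / δ = 64 * (R / δ) := by ring
          exact pow_le_pow_left₀ (by linarith) (by linarith) 3
      _ ≤ 300000 * (R / δ) ^ 3 := by rw [mul_pow]; gcongr; norm_num

/-! ### Rescaling the inside of a tube -/

namespace Line

/-- The line through `(b, 0)` with slope `w`. -/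
noncomputable def ofSlope (b w : E 4) (hb : b 3 = 0) (hb' : ∀ i, |b i| ≤ 1 / 4) (hw : w 3 = 1)
    (hw' : ‖w‖ ≤ 2) : Line 4 where
  base := b
  dir := ‖w‖⁻¹ • w
  base_last i hi := by
    obtain rfl : i = 3 := Fin.ext (by simpa using hi)
    exact hb
  base_le := by simpa using hb'
  dir_norm := by
    have : w ≠ 0 := by rintro rfl; simp at hw
    rw [norm_smul, norm_inv, norm_norm, inv_mul_cancel₀ (norm_ne_zero_iff.2 this)]
  dir_last i hi := by
    obtain rfl : i = 3 := Fin.ext (by simpa using hi)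
    have : w ≠ 0 := by rintro rfl; simp at hw
    rw [PiLp.smul_apply, hw, smul_eq_mul, mul_one, one_div]
    exact inv_anti₀ (norm_pos_iff.2 this) hw'

theorem slope_ofSlope (b w : E 4) (hb hb' hw hw') :
    (ofSlope b w hb hb' hw hw').slope = w := by
  have : w ≠ 0 := by rintro rfl; simp at hw
  have h0 := norm_ne_zero_iff.2 this
  simp only [slope, ofSlope, PiLp.smul_apply, smul_eq_mul, hw, mul_one, inv_inv, smul_smul,
    mul_inv_cancel₀ h0, one_smul]

variable (u : Line 4) (ρ : ℝ)

/-- The rescaling that maps the axis `u` to the vertical axis: a shear along `u`, then a dilation of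
the horizontal coordinates by `1 / (48 ρ)` and of the vertical one by `1 / 2`. The latter keeps
images of points of `[-1, 1]⁴` away from the boundary of `[-1, 1]⁴`. -/
noncomputable def rescalePoint (x : E 4) : E 4 :=
  WithLp.toLp 2 fun i =>
    if i = 3 then x 3 / 2 else (48 * ρ)⁻¹ * (x i - u.base i - x 3 * u.slope i)

/-- The horizontal part of the base of the image of `l` under `rescalePoint`. -/
noncomputable def rescaleBase (l : Line 4) : E 4 := (48 * ρ)⁻¹ • (l.base - u.base)

/-- The slope of the image of `l` under `rescalePoint`. -/
noncomputable def rescaleSlope (l : Line 4) : E 4 :=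
  EuclideanSpace.single 3 1 + (2 * (48 * ρ)⁻¹) • (l.slope - u.slope)

variable {u ρ} {l l' : Line 4}

theorem norm_slope_sub_le_of_d_le (h : l.d u ≤ ρ) : ‖l.slope - u.slope‖ ≤ 6 * ρ := by
  linarith [l.norm_slope_sub_le u, l.norm_dir_sub_le_angle u, l.angle_le_d u]

theorem abs_rescaleBase_le (hρ : 0 < ρ) (h : l.d u ≤ ρ) (i : Fin 4) :
    |u.rescaleBase ρ l i| ≤ 1 / 48 := by
  have h1 : |l.base i - u.base i| ≤ ρ :=
    (by simpa using PiLp.norm_apply_le (l.base - u.base) i : _ ≤ ‖l.base - u.base‖).trans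
      ((l.norm_base_sub_le_d u).trans h)
  simp only [rescaleBase, PiLp.smul_apply, PiLp.sub_apply, smul_eq_mul, abs_mul, abs_inv,
    abs_of_pos (show 0 < 48 * ρ by positivity)]
  rw [inv_mul_le_iff₀ (by positivity)]
  linarith

theorem norm_rescaleSlope_le (hρ : 0 < ρ) (h : l.d u ≤ ρ) : ‖u.rescaleSlope ρ l‖ ≤ 2 := by
  refine (norm_add_le _ _).trans ?_
  rw [norm_smul, Real.norm_eq_abs, abs_of_pos (by positivity), PiLp.norm_single]
  have : 2 * (48 * ρ)⁻¹ * ‖l.slope - u.slope‖ ≤ 2 * (48 * ρ)⁻¹ * (6 * ρ) := by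
    gcongr; exact norm_slope_sub_le_of_d_le h
  have e : 2 * (48 * ρ)⁻¹ * (6 * ρ) = 1 / 4 := by field_simp; norm_num
  rw [e] at this
  rw [norm_one]
  linarith

variable (u ρ l) in
open Classical in
/-- The image of a line close to `u` under `rescalePoint`; lines that are not within `ρ` of `u` get
the junk value `u`. -/
noncomputable def rescale : Line 4 :=
  if h : 0 < ρ ∧ l.d u ≤ ρ then
    ofSlope (u.rescaleBase ρ l) (u.rescaleSlope ρ l)
      (by simp [rescaleBase, l.base_last 3 rfl, u.base_last 3 rfl])
      (fun i => (abs_rescaleBase_le h.1 h.2 i).trans (by norm_num))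
      (by simp [rescaleSlope, slope_last]) (norm_rescaleSlope_le h.1 h.2)
  else u

theorem base_rescale (hρ : 0 < ρ) (h : l.d u ≤ ρ) :
    (u.rescale ρ l).base = u.rescaleBase ρ l := by
  rw [rescale, dif_pos ⟨hρ, h⟩]; rfl

theorem slope_rescale (hρ : 0 < ρ) (h : l.d u ≤ ρ) :
    (u.rescale ρ l).slope = u.rescaleSlope ρ l := by
  rw [rescale, dif_pos ⟨hρ, h⟩, slope_ofSlope]

theorem norm_base_rescale_sub (hρ : 0 < ρ) (h : l.d u ≤ ρ) (h' : l'.d u ≤ ρ) :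
    ‖(u.rescale ρ l).base - (u.rescale ρ l').base‖ = (48 * ρ)⁻¹ * ‖l.base - l'.base‖ := by
  rw [base_rescale hρ h, base_rescale hρ h', rescaleBase, rescaleBase, ← smul_sub,
    sub_sub_sub_cancel_right, norm_smul, Real.norm_eq_abs, abs_of_pos (by positivity)]

theorem norm_slope_rescale_sub (hρ : 0 < ρ) (h : l.d u ≤ ρ) (h' : l'.d u ≤ ρ) :
    ‖(u.rescale ρ l).slope - (u.rescale ρ l').slope‖ =
      2 * (48 * ρ)⁻¹ * ‖l.slope - l'.slope‖ := by
  rw [slope_rescale hρ h, slope_rescale hρ h', rescaleSlope, rescaleSlope,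
    add_sub_add_left_eq_sub, ← smul_sub, sub_sub_sub_cancel_right, norm_smul, Real.norm_eq_abs,
    abs_of_pos (by positivity)]

theorem d_rescale_le (hρ : 0 < ρ) (h : l.d u ≤ ρ) (h' : l'.d u ≤ ρ) :
    (u.rescale ρ l).d (u.rescale ρ l') ≤ l.d l' / ρ := by
  have h1 := (u.rescale ρ l).angle_le (u.rescale ρ l')
  have h2 := (u.rescale ρ l).norm_dir_sub_le (u.rescale ρ l')
  rw [norm_slope_rescale_sub hρ h h'] at h2
  have h3 := (l.norm_slope_sub_le l').trans
    (mul_le_mul_of_nonneg_left (l.norm_dir_sub_le_angle l') (by norm_num))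
  have h4 : 2 * (48 * ρ)⁻¹ * ‖l.slope - l'.slope‖ ≤
      2 * (48 * ρ)⁻¹ * (6 * angle l.dir l'.dir) := by gcongr
  have e : 2 * (48 * ρ)⁻¹ * (6 * angle l.dir l'.dir) = angle l.dir l'.dir / ρ / 4 := by
    field_simp; ring
  have e2 : (48 * ρ)⁻¹ * ‖l.base - l'.base‖ ≤ ‖l.base - l'.base‖ / ρ := by
    rw [mul_inv, div_eq_inv_mul]
    have : 0 ≤ ρ⁻¹ * ‖l.base - l'.base‖ := by positivity
    linarith
  simp only [d, norm_base_rescale_sub hρ h h', add_div]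
  linarith

theorem angle_le_angle_rescale (hρ : 0 < ρ) (h : l.d u ≤ ρ) (h' : l'.d u ≤ ρ) :
    angle l.dir l'.dir ≤ 576 * ρ * angle (u.rescale ρ l).dir (u.rescale ρ l').dir := by
  have h1 := l.angle_le l'
  have h2 := l.norm_dir_sub_le l'
  have h3 := ((u.rescale ρ l).norm_slope_sub_le (u.rescale ρ l')).trans
    (mul_le_mul_of_nonneg_left ((u.rescale ρ l).norm_dir_sub_le_angle (u.rescale ρ l'))
      (by norm_num))
  rw [norm_slope_rescale_sub hρ h h'] at h3
  have h4 := mul_le_mul_of_nonneg_left h3 (show 0 ≤ 24 * ρ by positivity)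
  have e : 24 * ρ * (2 * (48 * ρ)⁻¹ * ‖l.slope - l'.slope‖) = ‖l.slope - l'.slope‖ := by
    field_simp; norm_num
  rw [e] at h4
  linarith

theorem d_le_d_rescale (hρ : 0 < ρ) (h : l.d u ≤ ρ) (h' : l'.d u ≤ ρ) :
    l.d l' ≤ 576 * ρ * (u.rescale ρ l).d (u.rescale ρ l') := by
  have h1 := angle_le_angle_rescale hρ h h'
  have h2 : ‖l.base - l'.base‖ ≤ 576 * ρ * ((48 * ρ)⁻¹ * ‖l.base - l'.base‖) := by
    rw [← mul_assoc, show 576 * ρ * (48 * ρ)⁻¹ = 12 by field_simp; norm_num]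
    linarith [norm_nonneg (l.base - l'.base)]
  simp only [d, norm_base_rescale_sub hρ h h', mul_add]
  linarith

theorem mem_tube_of_abs_sub_le (l : Line 4) (hδ : 0 < δ) {y : E 4} (h1 : ∀ i, |y i| ≤ 1)
    (h2 : ∀ i, |y i - l.base i - y 3 * l.slope i| ≤ 3 * δ) : y ∈ l.tube δ := by
  refine ⟨Metric.mem_thickening_iff.2
    ⟨l.base + y 3 • l.slope, ⟨y 3 * (l.dir 3)⁻¹, by rw [slope, smul_smul]⟩, ?_⟩,
    fun i => abs_le.1 (h1 i)⟩
  rw [dist_eq_norm]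
  have : ‖y - (l.base + y 3 • l.slope)‖ ≤ 6 * δ := by
    refine le_of_sq_le_sq ?_ (by positivity)
    rw [EuclideanSpace.norm_sq_eq, Fin.sum_univ_four]
    have h : ∀ i, ‖(y - (l.base + y 3 • l.slope)) i‖ ^ 2 ≤ (3 * δ) ^ 2 := by
      intro i
      gcongr
      have := h2 i
      simpa [sub_sub] using this
    linarith [h 0, h 1, h 2, h 3]
  push_cast
  linarith

/-- The index of the `δ / ρ`-cube that contains the image of the corner of the `δ`-cube of
index `k`. -/
noncomputable def rescaleIndex (u : Line 4) (ρ δ : ℝ) (k : Fin 4 → ℤ) : Fin 4 → ℤ :=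
  cubeIndex (δ / ρ) (u.rescalePoint ρ (WithLp.toLp 2 fun i => δ * (k i : ℝ)))

/-- The rescaling maps cubes of a `δ`-tube to cubes of the rescaled `δ / ρ`-tube. -/
theorem cube_rescaleIndex_subset (hδ : 0 < δ) (hρ : 0 < ρ) (hδρ : δ / ρ ≤ 1 / 4) (h : l.d u ≤ ρ)
    {k : Fin 4 → ℤ} (hk : cube 4 δ k ⊆ l.tube δ) :
    cube 4 (δ / ρ) (u.rescaleIndex ρ δ k) ⊆ (u.rescale ρ l).tube (δ / ρ) := by
  have hδ' : 0 < δ / ρ := by positivity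
  set x : E 4 := WithLp.toLp 2 fun i => δ * (k i : ℝ) with hx
  set z := u.rescalePoint ρ x with hz
  have hxt : x ∈ l.tube δ := hk (cube_corner_mem hδ k)
  intro y hy
  have hyz : ∀ i, |y i - z i| ≤ δ / ρ := by
    intro i
    have h1 := hy i
    have h2 := (mem_cube_iff hδ' (x := z)).2 rfl i
    rw [Set.mem_Ico] at h1 h2
    change _ ≤ y i ∧ _ at h1
    change δ / ρ * (u.rescaleIndex ρ δ k i) ≤ z i ∧
      z i < δ / ρ * (u.rescaleIndex ρ δ k i) + δ / ρ at h2
    rw [abs_le]; constructor <;> linarith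
  have hz3 : z 3 = x 3 / 2 := by simp [hz, rescalePoint]
  have hzi : ∀ i, i ≠ 3 → z i = (48 * ρ)⁻¹ * (x i - u.base i - x 3 * u.slope i) := by
    intro i hi; simp [hz, rescalePoint, hi]
  have hb := abs_rescaleBase_le hρ h
  have hx3 : |x 3| ≤ 1 := abs_le.2 (hxt.2 3)
  have hy3 : |y 3| ≤ 1 := by
    have : |y 3| ≤ |y 3 - z 3| + |z 3| := by simpa using abs_add_le (y 3 - z 3) (z 3)
    have h3 : |z 3| = |x 3| / 2 := by rw [hz3, abs_div, abs_two]
    linarith [hyz 3]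
  have hs : ∀ i, i ≠ 3 → |u.rescaleSlope ρ l i| ≤ 1 / 4 := by
    intro i hi
    have h1 := (PiLp.norm_apply_le (l.slope - u.slope) i).trans (norm_slope_sub_le_of_d_le h)
    rw [Real.norm_eq_abs] at h1
    simp only [rescaleSlope, PiLp.add_apply, PiLp.smul_apply, smul_eq_mul,
      PiLp.single_apply, if_neg hi, zero_add]
    rw [abs_mul, abs_of_pos (show 0 < 2 * (48 * ρ)⁻¹ by positivity)]
    calc _ ≤ 2 * (48 * ρ)⁻¹ * (6 * ρ) := by gcongr
      _ = 1 / 4 := by field_simp; norm_num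
  have hnear : ∀ i, |y i - u.rescaleBase ρ l i - y 3 * u.rescaleSlope ρ l i| ≤ 2 * (δ / ρ) := by
    intro i
    by_cases hi : i = 3
    · subst hi
      have e1 : u.rescaleBase ρ l 3 = 0 := by
        simp [rescaleBase, l.base_last 3 rfl, u.base_last 3 rfl]
      have e2 : u.rescaleSlope ρ l 3 = 1 := by simp [rescaleSlope, slope_last]
      rw [e1, e2]; simp; positivity
    have e0 : z i - u.rescaleBase ρ l i - z 3 * u.rescaleSlope ρ l i =
        (48 * ρ)⁻¹ * (x i - l.base i - x 3 * l.slope i) := by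
      rw [hzi i hi, hz3]
      simp only [rescaleSlope, rescaleBase, PiLp.add_apply, PiLp.smul_apply, smul_eq_mul,
        PiLp.single_apply, if_neg hi, PiLp.sub_apply]
      ring
    have e : y i - u.rescaleBase ρ l i - y 3 * u.rescaleSlope ρ l i =
        (48 * ρ)⁻¹ * (x i - l.base i - x 3 * l.slope i) + (y i - z i)
          - (y 3 - z 3) * u.rescaleSlope ρ l i := by
      rw [← e0]; ring
    have h1 : |(48 * ρ)⁻¹ * (x i - l.base i - x 3 * l.slope i)| ≤ δ / ρ / 2 := by
      rw [abs_mul, abs_of_pos (show 0 < (48 * ρ)⁻¹ by positivity)]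
      calc _ ≤ (48 * ρ)⁻¹ * (24 * δ) := by gcongr; exact l.abs_sub_le_of_mem_tube hxt i
        _ = _ := by field_simp; norm_num
    have h2 : |(y 3 - z 3) * u.rescaleSlope ρ l i| ≤ δ / ρ * (1 / 4) := by
      rw [abs_mul]
      exact mul_le_mul (hyz 3) (hs i hi) (abs_nonneg _) hδ'.le
    rw [e]
    refine (abs_sub _ _).trans ?_
    have := abs_add_le ((48 * ρ)⁻¹ * (x i - l.base i - x 3 * l.slope i)) (y i - z i)
    linarith [hyz i]
  refine mem_tube_of_abs_sub_le _ hδ' (fun i => ?_) fun i => ?_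
  · by_cases hi : i = 3
    · rw [hi]; exact hy3
    have e : y i = (y i - u.rescaleBase ρ l i - y 3 * u.rescaleSlope ρ l i)
      + u.rescaleBase ρ l i + y 3 * u.rescaleSlope ρ l i := by ring
    have h1 : |y 3 * u.rescaleSlope ρ l i| ≤ 1 * (1 / 4) := by
      rw [abs_mul]
      exact mul_le_mul hy3 (hs i hi) (abs_nonneg _) (by norm_num)
    rw [e]
    refine (abs_add_three _ _ _).trans ?_
    linarith [hnear i, hb i]
  · rw [base_rescale hρ h, slope_rescale hρ h]
    linarith [hnear i]

open Classical in
/-- At most `≲ 1 / ρ` of the cubes of a `δ`-tube are rescaled to the same `δ / ρ`-cube. -/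
theorem card_le_card_image_rescaleIndex (hδ : 0 < δ) (hρ : 0 < ρ) (hρ1 : ρ ≤ 1)
    (s : Finset (Fin 4 → ℤ)) (hs : ∀ k ∈ s, cube 4 δ k ⊆ l.tube δ) :
    (s.card : ℝ) ≤ 352947 / ρ * (s.image (u.rescaleIndex ρ δ)).card := by
  have hfib : ∀ m ∈ s.image (u.rescaleIndex ρ δ),
      (s.filter fun k => u.rescaleIndex ρ δ k = m).card ≤ ⌊352947 / ρ⌋₊ := by
    intro m _
    refine Nat.le_floor ((l.card_cubes_le (L := 2 * (δ / ρ)) (a := 2 * (δ / ρ) * m 3) hδ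
      (by positivity) _ (fun k hk => hs k (Finset.mem_filter.1 hk).1) ?_).trans ?_)
    · intro k hk
      have h3 : u.rescaleIndex ρ δ k 3 = m 3 := by rw [(Finset.mem_filter.1 hk).2]
      simp only [rescaleIndex, cubeIndex, rescalePoint, if_true, Int.floor_eq_iff] at h3
      rw [le_div_iff₀ (by positivity), div_lt_iff₀ (by positivity)] at h3
      constructor <;> linarith [h3.1, h3.2]
    · rw [show 2 * (δ / ρ) / δ = 2 / ρ by field_simp, div_add_one hρ.ne', ← mul_div_assoc]
      gcongr
      linarith
  have h := Finset.card_le_mul_card_image s _ hfib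
  calc (s.card : ℝ) ≤ ⌊352947 / ρ⌋₊ * (s.image (u.rescaleIndex ρ δ)).card := by exact_mod_cast h
    _ ≤ _ := by gcongr; exact Nat.floor_le (by positivity)

/-- A `δ`-tube contains at most `≲ 1 / δ` cubes of side `δ`. -/
theorem card_cubes_le_div (l : Line 4) (hδ : 0 < δ) (hδ1 : δ ≤ 1) (s : Finset (Fin 4 → ℤ))
    (hs : ∀ k ∈ s, cube 4 δ k ⊆ l.tube δ) : (s.card : ℝ) ≤ 352947 / δ := by
  refine (l.card_cubes_le (L := 2) (a := -1) hδ (by norm_num) s hs fun k hk => ?_).trans ?_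
  · have := (hs k hk (cube_corner_mem hδ k)).2 3
    rw [Set.mem_Icc] at this
    exact ⟨this.1, by linarith [this.2]⟩
  · rw [div_add_one hδ.ne', ← mul_div_assoc]
    gcongr
    linarith

end Line

/-! ### Cubes of high multiplicity inside a tube -/

open Classical in
/-- A finite set with a reflexive relation of degree at most `D` has an independent subset that
carries at least the fraction `1 / D` of any given nonnegative weight. -/
theorem exists_independent_subset {α : Type*} (r : α → α → Prop) (hr : ∀ a, r a a)
    (hsymm : ∀ a b, r a b → r b a) (w : α → ℝ) (hw : ∀ a, 0 ≤ w a) {D : ℝ} (S : Finset α)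
    (hD : ∀ a ∈ S, ((S.filter fun b => r a b).card : ℝ) ≤ D) :
    ∃ I ⊆ S, (∀ a ∈ I, ∀ b ∈ I, a ≠ b → ¬ r a b) ∧ ∑ a ∈ S, w a ≤ D * ∑ a ∈ I, w a := by
  induction S using Finset.strongInduction with
  | H S ih =>
    rcases S.eq_empty_or_nonempty with rfl | hne
    · exact ⟨∅, le_rfl, by simp, by simp⟩
    -- The greedy choice: an element of maximal weight outweighs each of its neighbours.
    obtain ⟨a, haS, ha⟩ := S.exists_max_image w hne
    have hsub : (S.filter fun b => ¬ r a b) ⊂ S :=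
      Finset.filter_ssubset.2 ⟨a, haS, not_not.2 (hr a)⟩
    obtain ⟨I, hIS, hI, hsum⟩ := ih _ hsub fun b hb => by
      refine le_trans ?_ (hD b (hsub.1 hb))
      exact_mod_cast Finset.card_le_card (Finset.filter_subset_filter _ hsub.1)
    have hna : ∀ b ∈ I, ¬ r a b := fun b hb => (Finset.mem_filter.1 (hIS hb)).2
    have haI : a ∉ I := fun h => hna a h (hr a)
    refine ⟨insert a I, Finset.insert_subset haS (hIS.trans hsub.1), ?_, ?_⟩
    · intro b hb c hc hbc
      rw [Finset.mem_insert] at hb hc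
      rcases hb with rfl | hb <;> rcases hc with rfl | hc
      · exact absurd rfl hbc
      · exact hna c hc
      · exact fun h => hna b hb (hsymm _ _ h)
      · exact hI b hb c hc hbc
    · rw [Finset.sum_insert haI, mul_add, ← Finset.sum_filter_add_sum_filter_not S (r a)]
      refine add_le_add ?_ hsum
      calc ∑ b ∈ S.filter (r a), w b ≤ ∑ _b ∈ S.filter (r a), w a :=
            Finset.sum_le_sum fun b hb => ha b (Finset.mem_filter.1 hb).1
        _ = (S.filter (r a)).card * w a := by rw [Finset.sum_const, nsmul_eq_mul]
        _ ≤ D * w a := mul_le_mul_of_nonneg_right (hD a haS) (hw a)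

namespace ShadedTubes

open Classical in
/-- The tubes of the collection that are covered by the `ρ`-tube with axis `u`. -/
noncomputable def coveredBy (C : ShadedTubes 4 δ) (u : Line 4) (ρ : ℝ) : Finset (Line 4) :=
  C.tubes.filter fun l => l.d u ≤ ρ / 2

open Classical in
/-- The cubes of the shading of `l` that lie in the shadings of at least `K` of the tubes covered by
the `ρ`-tube with axis `u`. -/
noncomputable def heavy (C : ShadedTubes 4 δ) (u : Line 4) (ρ K : ℝ) (l : Line 4) :
    Finset (Fin 4 → ℤ) :=
  (C.Y l).filter fun k => K ≤ ((C.coveredBy u ρ).filter fun l' => k ∈ C.Y l').card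

open Classical in
/-- The `δ / ρ`-tubes obtained by rescaling the tubes of a set `I` of lines close to `u`, shaded by
the cubes that contain the image of the corner of a cube of the shading `Z`. -/
noncomputable def rescaled (u : Line 4) (ρ : ℝ) (I : Finset (Line 4))
    (Z : Line 4 → Finset (Fin 4 → ℤ)) (hδ : 0 < δ) (hρ : 0 < ρ) (hδρ : δ / ρ ≤ 1 / 4)
    (hI : ∀ l ∈ I, l.d u ≤ ρ) (hZ : ∀ l ∈ I, ∀ k ∈ Z l, cube 4 δ k ⊆ l.tube δ) :
    ShadedTubes 4 (δ / ρ) where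
  tubes := I.image (u.rescale ρ)
  Y l' := (I.filter fun l => u.rescale ρ l = l').biUnion
    fun l => (Z l).image (u.rescaleIndex ρ δ)
  subset_tube l' _ m hm := by
    simp only [Finset.mem_biUnion, Finset.mem_filter, Finset.mem_image] at hm
    obtain ⟨l, ⟨hl, rfl⟩, k, hk, rfl⟩ := hm
    exact Line.cube_rescaleIndex_subset hδ hρ hδρ (hI l hl) (hZ l hl k hk)

/-- Covers of a sticky collection at scales `≤ ρ` rescale to covers of the part of the collection
inside a `ρ`-tube. -/
theorem StickyCovered.rescale {C : ShadedTubes 4 δ} {u : Line 4} {ρ η t : ℝ}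
    (hs : C.StickyCovered η) (hδ : 0 < δ) (hρ : 0 < ρ) (hρ1 : ρ ≤ 1)
    (hη : 10000000000000 * δ ^ (-η) ≤ (δ / ρ) ^ (-t)) {C' : ShadedTubes 4 (δ / ρ)}
    (hC' : ∀ l' ∈ C'.tubes, ∃ l ∈ C.coveredBy u ρ, u.rescale ρ l = l') :
    C'.StickyCovered t := by
  classical
  intro ρ' hρ'δ hρ'1
  have hρ' : 0 < ρ' := lt_of_lt_of_le (by positivity) hρ'δ
  have hle : ρ * ρ' ≤ ρ := mul_le_of_le_one_right hρ.le hρ'1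
  obtain ⟨U, hcov, hU⟩ := hs (ρ * ρ') (by rw [div_le_iff₀ hρ] at hρ'δ; linarith) (hle.trans hρ1)
  refine ⟨(U.filter fun v => v.d u ≤ ρ).image (u.rescale ρ), ?_, ?_⟩
  · intro l' hl'
    obtain ⟨l, hl, rfl⟩ := hC' l' hl'
    rw [coveredBy, Finset.mem_filter] at hl
    obtain ⟨v, hv, hlv⟩ := hcov l hl.1
    have hvu : v.d u ≤ ρ := by
      have := v.d_triangle l u
      rw [v.d_comm l] at this
      linarith [hl.2]
    refine ⟨_, Finset.mem_image_of_mem _ (Finset.mem_filter.2 ⟨hv, hvu⟩), ?_⟩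
    refine (Line.d_rescale_le hρ (by linarith [hl.2]) hvu).trans ?_
    rw [div_le_iff₀ hρ]
    linarith
  · intro v' hv'
    obtain ⟨v, hv, rfl⟩ := Finset.mem_image.1 hv'
    rw [Finset.mem_filter] at hv
    refine le_trans ?_ hη
    have hsub : ((U.filter fun v => v.d u ≤ ρ).image (u.rescale ρ)).filter
        (fun w' => angle w'.dir (u.rescale ρ v).dir ≤ ρ') ⊆
        (U.filter fun w => angle w.dir v.dir ≤ 576 * (ρ * ρ')).image (u.rescale ρ) := by
      intro w' hw'
      obtain ⟨hw', ha⟩ := Finset.mem_filter.1 hw'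
      obtain ⟨w, hw, rfl⟩ := Finset.mem_image.1 hw'
      rw [Finset.mem_filter] at hw
      refine Finset.mem_image_of_mem _ (Finset.mem_filter.2 ⟨hw.1, ?_⟩)
      refine (Line.angle_le_angle_rescale hρ hw.2 hv.2).trans ?_
      rw [← mul_assoc]
      gcongr
    refine le_trans (by exact_mod_cast (Finset.card_le_card hsub).trans Finset.card_image_le)
      ((card_le_of_parallel_le (R := 576 * (ρ * ρ')) (by positivity) (by positivity)
        (by positivity) hU (Finset.filter_subset _ _) v.dir fun w hw =>
        (w.norm_dir_sub_le_angle v).trans (Finset.mem_filter.1 hw).2).trans ?_)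
    gcongr
    rw [show 32 * (576 * (ρ * ρ')) / (ρ * ρ') = 18432 by field_simp; norm_num]
    norm_num

/-- The heavy cubes inside a `ρ`-tube carry little mass: otherwise the rescaled heavy shading would
be admissible at scale `δ / ρ`, and so its union would have volume at least `θ`; but every cube of
that union has multiplicity at least `K`, so that its volume is `≲ δ^(-η) / K`. -/
theorem sum_card_heavy_le (C : ShadedTubes 4 δ) {s t η θ K ρ : ℝ} (hδ : 0 < δ) (hρ : 0 < ρ)
    (hρ1 : ρ ≤ 1) (hδρ : δ / ρ ≤ 1 / 4) (hd : C.EssentiallyDistinct) (hs : C.StickyCovered η)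
    (hη : 10000000000000 * δ ^ (-η) ≤ (δ / ρ) ^ (-t))
    (hM : ∀ D : ShadedTubes 4 (δ / ρ), D.Admissible s t → θ ≤ volume.real D.union)
    (hK : 0 < K) (hKθ : 200000000000 * δ ^ (-η) < K * θ) (u : Line 4) :
    (∑ l ∈ C.coveredBy u ρ, ((C.heavy u ρ K l).card : ℝ)) * δ ^ 4 ≤
      40000000000000000000 * δ ^ (-η) * ρ ^ 3 * (δ / ρ) ^ s := by
  classical
  have hδ' : 0 < δ / ρ := by positivity
  have hδle : δ ≤ ρ := by rw [div_le_iff₀ hρ] at hδρ; linarith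
  set S := C.coveredBy u ρ with hS
  have hST : S ⊆ C.tubes := Finset.filter_subset _ _
  have hSu : ∀ l ∈ S, l.d u ≤ ρ := fun l hl => by
    linarith [(Finset.mem_filter.1 hl).2]
  have hZ : ∀ l ∈ S, ∀ k ∈ C.heavy u ρ K l, cube 4 δ k ⊆ l.tube δ := fun l hl k hk =>
    C.subset_tube l (hST hl) k (Finset.mem_filter.1 hk).1
  set w : Line 4 → ℝ := fun l => ((C.heavy u ρ K l).image (u.rescaleIndex ρ δ)).card with hw
  -- Lines whose images are not essentially distinct have distance `≲ δ`.
  obtain ⟨I, hIS, hI, hsum⟩ := exists_independent_subset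
    (fun l l' => (u.rescale ρ l).d (u.rescale ρ l') ≤ δ / ρ)
    (fun l => by simpa [Line.d, angle_self (norm_ne_zero_iff.1 (by simp [Line.dir_norm] :
      ‖(u.rescale ρ l).dir‖ ≠ 0))] using hδ'.le) (fun l l' h => by rwa [Line.d_comm])
    w (fun _ => Nat.cast_nonneg _) (D := 100000000000000 * δ ^ (-η)) S (by
      intro l hl
      refine (C.card_le_of_norm_dir_sub_le (R := 576 * δ) hδ (hδle.trans hρ1) hd hs (by linarith)
        ((Finset.filter_subset _ _).trans hST) l.dir fun l' hl' => ?_).trans ?_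
      · obtain ⟨hl'S, hll'⟩ := Finset.mem_filter.1 hl'
        have h1 := Line.d_le_d_rescale hρ (hSu l hl) (hSu l' hl'S)
        rw [l.d_comm] at h1
        refine ((l'.norm_dir_sub_le_angle l).trans (l'.angle_le_d l)).trans (h1.trans ?_)
        calc _ ≤ 576 * ρ * (δ / ρ) := by gcongr
          _ = _ := by field_simp
      · gcongr
        rw [mul_div_assoc, div_self hδ.ne']
        norm_num)
  set D := rescaled u ρ I (C.heavy u ρ K) hδ hρ hδρ (fun l hl => hSu l (hIS hl))
    (fun l hl => hZ l (hIS hl)) with hD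
  have hinj : Set.InjOn (u.rescale ρ) I := by
    intro l hl l' hl' h
    by_contra hne
    refine hI l hl l' hl' hne ?_
    rw [h]
    simpa [Line.d, angle_self (norm_ne_zero_iff.1 (by simp [Line.dir_norm] :
      ‖(u.rescale ρ l').dir‖ ≠ 0))] using hδ'.le
  have hmass : (∑ l ∈ I, w l) * (δ / ρ) ^ 4 ≤ D.mass := by
    rw [mass_eq hδ']
    gcongr
    change _ ≤ ∑ l ∈ I.image (u.rescale ρ), _
    rw [Finset.sum_image hinj]
    refine Finset.sum_le_sum fun l hl => ?_
    rw [hw]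
    refine Nat.cast_le.2 (Finset.card_le_card ?_)
    exact Finset.subset_biUnion_of_mem (fun l => (C.heavy u ρ K l).image (u.rescaleIndex ρ δ))
      (Finset.mem_filter.2 ⟨hl, rfl⟩)
  have hnot : D.mass < (δ / ρ) ^ s := by
    by_contra! hge
    have hadm : D.Admissible s t := by
      refine ⟨?_, ?_, hge⟩
      · intro l₁ h₁ l₂ h₂ hne
        obtain ⟨l, hl, rfl⟩ := Finset.mem_image.1 h₁
        obtain ⟨l', hl', rfl⟩ := Finset.mem_image.1 h₂
        exact not_le.1 (hI l hl l' hl' fun h => hne (by rw [h]))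
      · refine hs.rescale (u := u) hδ hρ hρ1 hη fun l' hl' => ?_
        obtain ⟨l, hl, rfl⟩ := Finset.mem_image.1 hl'
        exact ⟨l, hIS hl, rfl⟩
    have hθ := hM D hadm
    rw [volume_real_union hδ'] at hθ
    -- Double counting of the pairs of a rescaled heavy cube and a tube through it.
    have hcount : K * D.cubes.card ≤ ∑ l ∈ S, w l := by
      have h1 : ∀ m ∈ D.cubes, K ≤ (S.filter fun l =>
          m ∈ (C.heavy u ρ K l).image (u.rescaleIndex ρ δ)).card := by
        intro m hm
        simp only [cubes, hD, rescaled, Finset.mem_biUnion, Finset.mem_filter,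
          Finset.mem_image] at hm
        obtain ⟨_, -, l, -, k, hk, rfl⟩ := hm
        refine (Finset.mem_filter.1 hk).2.trans ?_
        refine Nat.cast_le.2 (Finset.card_le_card fun l' hl' => ?_)
        rw [Finset.mem_filter] at hl' ⊢
        exact ⟨hl'.1, Finset.mem_image_of_mem _
          (Finset.mem_filter.2 ⟨hl'.2, (Finset.mem_filter.1 hk).2⟩)⟩
      calc K * D.cubes.card = ∑ _m ∈ D.cubes, K := by
            rw [Finset.sum_const, nsmul_eq_mul, mul_comm]
        _ ≤ ∑ m ∈ D.cubes, ((S.filter fun l =>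
              m ∈ (C.heavy u ρ K l).image (u.rescaleIndex ρ δ)).card : ℝ) :=
            Finset.sum_le_sum h1
        _ = ∑ l ∈ S, ((D.cubes.filter fun m =>
              m ∈ (C.heavy u ρ K l).image (u.rescaleIndex ρ δ)).card : ℝ) := by
            exact_mod_cast (Finset.sum_card_bipartiteAbove_eq_sum_card_bipartiteBelow
              (s := S) (t := D.cubes)
              (fun l m => m ∈ (C.heavy u ρ K l).image (u.rescaleIndex ρ δ))).symm
        _ ≤ ∑ l ∈ S, w l := by
            refine Finset.sum_le_sum fun l _ => Nat.cast_le.2 (Finset.card_le_card fun m hm => ?_)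
            exact (Finset.mem_filter.1 hm).2
    have hwle : ∀ l ∈ S, w l ≤ 352947 / (δ / ρ) := by
      intro l hl
      refine (u.rescale ρ l).card_cubes_le_div hδ' (by linarith) _ fun m hm => ?_
      obtain ⟨k, hk, rfl⟩ := Finset.mem_image.1 hm
      exact Line.cube_rescaleIndex_subset hδ hρ hδρ (hSu l hl) (hZ l hl k hk)
    have hScard : (S.card : ℝ) ≤ 300000 * (ρ / δ) ^ 3 * δ ^ (-η) :=
      C.card_le_of_norm_dir_sub_le hδ (hδle.trans hρ1) hd hs hδle hST u.dir fun l hl =>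
        ((l.norm_dir_sub_le_angle u).trans (l.angle_le_d u)).trans (hSu l hl)
    have h2 : ∑ l ∈ S, w l ≤ 300000 * (ρ / δ) ^ 3 * δ ^ (-η) * (352947 / (δ / ρ)) := by
      refine (Finset.sum_le_sum hwle).trans ?_
      rw [Finset.sum_const, nsmul_eq_mul]
      gcongr
    have h3 : K * θ ≤ 200000000000 * δ ^ (-η) := by
      calc K * θ ≤ K * (D.cubes.card * (δ / ρ) ^ 4) := by gcongr
        _ = (K * D.cubes.card) * (δ / ρ) ^ 4 := by ring
        _ ≤ 300000 * (ρ / δ) ^ 3 * δ ^ (-η) * (352947 / (δ / ρ)) * (δ / ρ) ^ 4 := by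
            exact mul_le_mul_of_nonneg_right (hcount.trans h2) (by positivity)
        _ = 105884100000 * δ ^ (-η) := by field_simp; norm_num
        _ ≤ _ := by gcongr; norm_num
    linarith
  have h1 : ∑ l ∈ S, ((C.heavy u ρ K l).card : ℝ) ≤ 352947 / ρ * ∑ l ∈ S, w l := by
    rw [Finset.mul_sum]
    exact Finset.sum_le_sum fun l hl =>
      Line.card_le_card_image_rescaleIndex hδ hρ hρ1 _ (hZ l hl)
  have h2 : ∑ l ∈ I, w l ≤ (δ / ρ) ^ s / (δ / ρ) ^ 4 := by
    rw [le_div_iff₀ (by positivity)]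
    exact hmass.trans hnot.le
  calc (∑ l ∈ S, ((C.heavy u ρ K l).card : ℝ)) * δ ^ 4
      ≤ 352947 / ρ * (100000000000000 * δ ^ (-η) * ((δ / ρ) ^ s / (δ / ρ) ^ 4)) * δ ^ 4 := by
        gcongr
        refine h1.trans ?_
        gcongr
        exact hsum.trans (by gcongr)
    _ = 35294700000000000000 * δ ^ (-η) * ρ ^ 3 * (δ / ρ) ^ s := by
        generalize (δ / ρ) ^ s = x
        field_simp; ring
    _ ≤ _ := by gcongr; norm_num

end ShadedTubes

/-! ### The exponent `σ` -/

theorem Line.tube_subset (l : Line n) :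
    l.tube δ ⊆ {x : E n | ∀ i, x i ∈ Set.Icc (-1 : ℝ) 1} := Set.inter_subset_right

theorem volume_box (n : ℕ) :
    volume {x : E n | ∀ i, x i ∈ Set.Icc (-1 : ℝ) 1} = ENNReal.ofReal (2 ^ n) := by
  have h : {x : E n | ∀ i, x i ∈ Set.Icc (-1 : ℝ) 1} = WithLp.ofLp ⁻¹'
      (Set.univ.pi fun _ => Set.Icc (-1 : ℝ) 1) := by
    ext x; simp [Pi.le_def, forall_and]
  rw [h, (PiLp.volume_preserving_ofLp (Fin n)).measure_preimage
    (MeasurableSet.univ_pi fun _ => measurableSet_Icc).nullMeasurableSet,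
    Set.pi_univ_Icc, Real.volume_Icc_pi]
  norm_num

theorem ShadedTubes.volume_real_union_le (C : ShadedTubes n δ) :
    volume.real C.union ≤ 2 ^ n := by
  have hsub : C.union ⊆ {x : E n | ∀ i, x i ∈ Set.Icc (-1 : ℝ) 1} := by
    refine Set.iUnion₂_subset fun l hl => Set.iUnion₂_subset fun k hk => ?_
    exact (C.subset_tube l hl k hk).trans l.tube_subset
  refine (measureReal_mono hsub (by rw [volume_box]; exact ENNReal.ofReal_ne_top)).trans ?_
  rw [Measure.real, volume_box, ENNReal.toReal_ofReal (by positivity)]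

theorem ShadedTubes.Admissible.le_volume_union {C : ShadedTubes n δ} {s t : ℝ} (hδ : 0 < δ)
    (h : C.Admissible s t) : δ ^ n ≤ volume.real C.union :=
  C.union_pos_of_mass_pos hδ ((Real.rpow_pos_of_pos hδ s).trans_le h.mass_ge)

theorem bddBelow_volumes (s t δ : ℝ) :
    BddBelow {m | ∃ C : ShadedTubes n δ, C.Admissible s t ∧ m = volume.real C.union} :=
  ⟨0, by rintro _ ⟨C, -, rfl⟩; exact measureReal_nonneg⟩

/-- If there is no admissible pair then `M` is the junk value `0`. -/
theorem M_eq_zero_or (s t : ℝ) (hδ : 0 < δ) :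
    M n s t δ = 0 ∨ δ ^ n ≤ M n s t δ ∧ M n s t δ ≤ 2 ^ n := by
  rcases Set.eq_empty_or_nonempty
    {m | ∃ C : ShadedTubes n δ, C.Admissible s t ∧ m = volume.real C.union} with h | h
  · left; rw [M, h, Real.sInf_empty]
  · right
    refine ⟨le_csInf h ?_, ?_⟩
    · rintro _ ⟨C, hC, rfl⟩
      exact hC.le_volume_union hδ
    · obtain ⟨_, C, hC, rfl⟩ := h
      exact (csInf_le (bddBelow_volumes s t δ) ⟨C, hC, rfl⟩).trans C.volume_real_union_le

theorem log_M_div_log_le (s t : ℝ) (hδ : 0 < δ) (hδ1 : δ < 1) :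
    Real.log (M n s t δ) / Real.log δ ≤ n := by
  have hlog := Real.log_neg hδ hδ1
  rcases M_eq_zero_or (n := n) s t hδ with h | ⟨h, -⟩
  · rw [h]; simp
  · rw [div_le_iff_of_neg hlog, ← Real.log_pow]
    exact Real.log_le_log (by positivity) h

theorem le_log_M_div_log (s t : ℝ) (hδ : 0 < δ) (hδ1 : δ < 1) :
    Real.log (2 ^ n) / Real.log δ ≤ Real.log (M n s t δ) / Real.log δ := by
  have hlog := Real.log_neg hδ hδ1
  have h2 : 0 ≤ Real.log ((2 : ℝ) ^ n) := Real.log_nonneg (one_le_pow₀ (by norm_num))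
  rcases M_eq_zero_or (n := n) s t hδ with h | ⟨h, h'⟩
  · rw [h]; simpa using div_nonpos_of_nonneg_of_nonpos h2 hlog.le
  · exact div_le_div_of_nonpos_of_le hlog.le
      (Real.log_le_log (lt_of_lt_of_le (by positivity) h) h')

theorem eventually_mem_Ioo_zero_one : ∀ᶠ δ : ℝ in 𝓝[>] 0, 0 < δ ∧ δ < 1 :=
  Ioo_mem_nhdsGT one_pos

theorem isBoundedUnder_log_M_div_log (s t : ℝ) :
    (𝓝[>] (0 : ℝ)).IsBoundedUnder (· ≤ ·) fun δ => Real.log (M n s t δ) / Real.log δ :=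
  ⟨n, eventually_map.2 (eventually_mem_Ioo_zero_one.mono fun _ h => log_M_div_log_le s t h.1 h.2)⟩

theorem N_nonneg (s t : ℝ) : 0 ≤ N n s t := by
  have hlim : Tendsto (fun δ : ℝ => Real.log (2 ^ n) / Real.log δ) (𝓝[>] 0) (𝓝 0) :=
    Real.tendsto_log_nhdsGT_zero.const_div_atBot _
  refine le_of_forall_lt fun a ha => ?_
  refine lt_of_lt_of_le (b := a / 2) (by linarith) ?_
  refine le_limsup_of_frequently_le (Eventually.frequently ?_) (isBoundedUnder_log_M_div_log s t)
  filter_upwards [hlim.eventually (lt_mem_nhds (show a / 2 < 0 by linarith)),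
    eventually_mem_Ioo_zero_one] with δ h1 h2
  exact h1.le.trans (le_log_M_div_log s t h2.1 h2.2)

theorem sigma_nonneg (n : ℕ) : 0 ≤ sigma n :=
  Real.sInf_nonneg (by rintro _ ⟨s, -, t, -, rfl⟩; exact N_nonneg s t)

/-- For suitable `s, t > 0`, the unions of admissible pairs at small scales `δ` have volume at least
`δ^(σ + ε)`. -/
theorem exists_rpow_le_volume_union (n : ℕ) {ε : ℝ} (hε : 0 < ε) :
    ∃ s t δ₁ : ℝ, 0 < s ∧ 0 < t ∧ 0 < δ₁ ∧ ∀ δ : ℝ, 0 < δ → δ < δ₁ →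
      ∀ C : ShadedTubes n δ, C.Admissible s t → δ ^ (sigma n + ε) ≤ volume.real C.union := by
  obtain ⟨_, ⟨s, hs, t, ht, rfl⟩, hlt⟩ := exists_lt_of_csInf_lt
    (s := {a | ∃ s ∈ Set.Ioo (0 : ℝ) 1, ∃ t ∈ Set.Ioo (0 : ℝ) 1, a = N n s t})
    ⟨_, 1 / 2, by norm_num, 1 / 2, by norm_num, rfl⟩
    (show sInf _ < sigma n + ε from lt_add_of_pos_right _ hε)
  have hev := (eventually_lt_of_limsup_lt hlt (isBoundedUnder_log_M_div_log s t)).and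
    eventually_mem_Ioo_zero_one
  obtain ⟨δ₁, hδ₁, hsub⟩ := mem_nhdsGT_iff_exists_Ioo_subset.1 hev
  refine ⟨s, t, δ₁, hs.1, ht.1, hδ₁, fun δ hδ hδ' C hC => ?_⟩
  obtain ⟨h1, -, hδ1⟩ := hsub ⟨hδ, hδ'⟩
  have hle : M n s t δ ≤ volume.real C.union := csInf_le (bddBelow_volumes s t δ) ⟨C, hC, rfl⟩
  -- The infimum is not a junk value, because the pair `C` exists.
  have hpos : 0 < M n s t δ := lt_of_lt_of_le (pow_pos hδ n)
    (le_csInf ⟨_, C, hC, rfl⟩ (by rintro _ ⟨C', hC', rfl⟩; exact hC'.le_volume_union hδ))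
  refine le_trans ?_ hle
  rw [div_lt_iff_of_neg (Real.log_neg hδ hδ1), ← Real.log_rpow hδ] at h1
  exact ((Real.log_lt_log_iff (Real.rpow_pos_of_pos hδ _) hpos).1 h1).le

/-! ### Removing the heavy cubes -/

namespace ShadedTubes

open Classical in
/-- The collection with the cubes of `bad l` removed from the shading of each line `l`. -/
noncomputable def prune (C : ShadedTubes 4 δ) (bad : Line 4 → Finset (Fin 4 → ℤ)) :
    ShadedTubes 4 δ where
  tubes := C.tubes
  Y l := C.Y l \ bad l
  subset_tube l hl k hk := C.subset_tube l hl k (Finset.mem_sdiff.1 hk).1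

theorem mass_sub_le_mass_prune (C : ShadedTubes 4 δ) (bad : Line 4 → Finset (Fin 4 → ℤ))
    (hδ : 0 < δ) :
    C.mass - (∑ l ∈ C.tubes, ((bad l).card : ℝ)) * δ ^ 4 ≤ (C.prune bad).mass := by
  classical
  rw [mass_eq hδ, mass_eq hδ, ← sub_mul, ← Finset.sum_sub_distrib]
  refine mul_le_mul_of_nonneg_right (Finset.sum_le_sum fun l _ => ?_) (by positivity)
  have := Finset.le_card_sdiff (bad l) (C.Y l)
  have h : (C.Y l).card ≤ ((C.prune bad).Y l).card + (bad l).card := by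
    change _ ≤ (C.Y l \ bad l).card + _
    omega
  rw [sub_le_iff_le_add]
  exact_mod_cast h

open Classical in
/-- Suppose that at each scale `ρ ∈ P` the heavy cubes in a `ρ`-tube have mass at most `X ρ³`. Then
removing them for all tubes of the sticky covers at these scales costs a mass `≲ #P δ^(-η) X`, and
what is left has at most `≲ δ^(-η) K ρ` tubes through a given cube with directions in a given cone
of aperture at most `ρ`. -/
theorem exists_pruned (C : ShadedTubes 4 δ) {η X : ℝ} (hδ : 0 < δ) (hX : 0 ≤ X) (P : Finset ℝ)
    (K : ℝ → ℝ) (hK : ∀ ρ ∈ P, 0 ≤ K ρ) (hP : ∀ ρ ∈ P, δ ≤ ρ ∧ ρ ≤ 1) (hs : C.StickyCovered η)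
    (hheavy : ∀ ρ ∈ P, ∀ u, (∑ l ∈ C.coveredBy u ρ, ((C.heavy u ρ (K ρ) l).card : ℝ)) * δ ^ 4 ≤
      X * ρ ^ 3) :
    ∃ bad : Line 4 → Finset (Fin 4 → ℤ),
      C.mass - P.card * (40000 * δ ^ (-η) * X) ≤ (C.prune bad).mass ∧
      ∀ ρ ∈ P, ∀ k v r, r ≤ ρ →
        ((((C.prune bad).through k).filter fun l => angle l.dir v ≤ r).card : ℝ) ≤
          1000000 * δ ^ (-η) * K ρ := by
  have hU : ∀ ρ : ℝ, ∃ U : Finset (Line 4), ρ ∈ P →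
      (∀ l ∈ C.tubes, ∃ u ∈ U, l.d u ≤ ρ / 2) ∧
      ∀ u ∈ U, ((U.filter fun u' => angle u'.dir u.dir ≤ ρ).card : ℝ) ≤ δ ^ (-η) := by
    intro ρ
    by_cases hρ : ρ ∈ P
    · obtain ⟨U, hU⟩ := hs ρ (hP ρ hρ).1 (hP ρ hρ).2
      exact ⟨U, fun _ => hU⟩
    · exact ⟨∅, fun h => absurd h hρ⟩
  choose U hU using hU
  set bad : Line 4 → Finset (Fin 4 → ℤ) := fun l => P.biUnion fun ρ =>
    ((U ρ).filter fun u => l.d u ≤ ρ / 2).biUnion fun u => C.heavy u ρ (K ρ) l with hbad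
  refine ⟨bad, le_trans ?_ (C.mass_sub_le_mass_prune bad hδ), ?_⟩
  · have h1 : ∑ l ∈ C.tubes, ((bad l).card : ℝ) ≤
        ∑ ρ ∈ P, ∑ u ∈ U ρ, ∑ l ∈ C.coveredBy u ρ, ((C.heavy u ρ (K ρ) l).card : ℝ) := by
      have h2 : ∀ l, ((bad l).card : ℝ) ≤ ∑ ρ ∈ P, ∑ u ∈ U ρ,
          if l.d u ≤ ρ / 2 then ((C.heavy u ρ (K ρ) l).card : ℝ) else 0 := by
        intro l
        refine (Nat.cast_le.2 Finset.card_biUnion_le).trans ?_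
        rw [Nat.cast_sum]
        refine Finset.sum_le_sum fun ρ _ => ?_
        rw [← Finset.sum_filter]
        exact (Nat.cast_le.2 Finset.card_biUnion_le).trans (by rw [Nat.cast_sum])
      refine (Finset.sum_le_sum fun l _ => h2 l).trans (le_of_eq ?_)
      rw [Finset.sum_comm]
      refine Finset.sum_congr rfl fun ρ _ => ?_
      rw [Finset.sum_comm]
      refine Finset.sum_congr rfl fun u _ => ?_
      rw [coveredBy, Finset.sum_filter]
    have h3 : (∑ l ∈ C.tubes, ((bad l).card : ℝ)) * δ ^ 4 ≤
        P.card * (40000 * δ ^ (-η) * X) := by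
      refine (mul_le_mul_of_nonneg_right h1 (by positivity)).trans ?_
      rw [Finset.sum_mul, ← nsmul_eq_mul]
      refine Finset.sum_le_card_nsmul _ _ _ fun ρ hρ => ?_
      have hρ0 : 0 < ρ := hδ.trans_le (hP ρ hρ).1
      have hUcard : ((U ρ).card : ℝ) ≤ 40000 * ρ⁻¹ ^ 3 * δ ^ (-η) := by
        refine (card_le_of_parallel_le (R := 1) hρ0 (by norm_num) (by positivity) (hU ρ hρ).2
          le_rfl 0 (fun u _ => by simp [u.dir_norm])).trans ?_
        gcongr
        have h1 : 1 ≤ ρ⁻¹ := (one_le_inv₀ hρ0).2 (hP ρ hρ).2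
        calc (32 * 1 / ρ + 2) ^ 3 ≤ (34 * ρ⁻¹) ^ 3 := by
              gcongr
              rw [mul_one, div_eq_mul_inv]
              linarith
          _ ≤ 40000 * ρ⁻¹ ^ 3 := by rw [mul_pow]; gcongr; norm_num
      rw [Finset.sum_mul]
      refine (Finset.sum_le_card_nsmul _ _ _ fun u _ => hheavy ρ hρ u).trans ?_
      rw [nsmul_eq_mul]
      calc ((U ρ).card : ℝ) * (X * ρ ^ 3) ≤ 40000 * ρ⁻¹ ^ 3 * δ ^ (-η) * (X * ρ ^ 3) := by gcongr
        _ = _ := by field_simp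
    linarith
  · intro ρ hρ k v r hr
    have hρ0 : 0 < ρ := hδ.trans_le (hP ρ hρ).1
    set F := ((C.prune bad).through k).filter fun l => angle l.dir v ≤ r with hF
    rcases F.eq_empty_or_nonempty with h0 | ⟨l₀, hl₀⟩
    · rw [h0]
      have := hK ρ hρ
      simp only [Finset.card_empty, Nat.cast_zero]
      positivity
    have hFmem : ∀ l ∈ F, l ∈ C.tubes ∧ k ∈ C.Y l ∧ k ∉ bad l ∧ angle l.dir v ≤ r := by
      intro l hl
      obtain ⟨h1, h2⟩ := Finset.mem_filter.1 hl
      obtain ⟨h3, h4⟩ := Finset.mem_filter.1 h1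
      exact ⟨h3, (Finset.mem_sdiff.1 h4).1, (Finset.mem_sdiff.1 h4).2, h2⟩
    set V := (U ρ).filter fun u => ∃ l ∈ F, l.d u ≤ ρ / 2 with hV
    have hcov : F ⊆ V.biUnion fun u => F.filter fun l => l.d u ≤ ρ / 2 := by
      intro l hl
      obtain ⟨u, hu, hlu⟩ := (hU ρ hρ).1 l (hFmem l hl).1
      exact Finset.mem_biUnion.2
        ⟨u, Finset.mem_filter.2 ⟨hu, l, hl, hlu⟩, Finset.mem_filter.2 ⟨hl, hlu⟩⟩
    have hVcard : (V.card : ℝ) ≤ 1000000 * δ ^ (-η) := by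
      refine (card_le_of_parallel_le (R := 3 * ρ) hρ0 (by positivity) (by positivity)
        (hU ρ hρ).2 (Finset.filter_subset _ _) l₀.dir fun u hu => ?_).trans ?_
      · obtain ⟨-, l, hl, hlu⟩ := Finset.mem_filter.1 hu
        have h1 := angle_le_angle_add_angle l.dir v l₀.dir
        rw [angle_comm v] at h1
        have h2 := norm_sub_le_norm_sub_add_norm_sub u.dir l.dir l₀.dir
        have h3 := l.norm_dir_sub_le_angle l₀
        have h4 := (l.norm_dir_sub_le_angle u).trans (l.angle_le_d u)
        rw [norm_sub_rev] at h4
        linarith [(hFmem l hl).2.2.2, (hFmem l₀ hl₀).2.2.2]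
      · gcongr
        rw [show 32 * (3 * ρ) / ρ = 96 by field_simp; norm_num]
        norm_num
    have hone : ∀ u ∈ V, ((F.filter fun l => l.d u ≤ ρ / 2).card : ℝ) ≤ K ρ := by
      intro u hu
      obtain ⟨huU, l, hl, hlu⟩ := Finset.mem_filter.1 hu
      obtain ⟨hlT, hkY, hkbad, -⟩ := hFmem l hl
      have hlight : k ∉ C.heavy u ρ (K ρ) l := fun h => hkbad (Finset.mem_biUnion.2
        ⟨ρ, hρ, Finset.mem_biUnion.2 ⟨u, Finset.mem_filter.2 ⟨huU, hlu⟩, h⟩⟩)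
      rw [heavy, Finset.mem_filter, not_and, not_le] at hlight
      refine le_trans (Nat.cast_le.2 (Finset.card_le_card fun l' hl' => ?_)) (hlight hkY).le
      obtain ⟨h1, h2⟩ := Finset.mem_filter.1 hl'
      exact Finset.mem_filter.2
        ⟨Finset.mem_filter.2 ⟨(hFmem l' h1).1, h2⟩, (hFmem l' h1).2.1⟩
    calc (F.card : ℝ) ≤ ∑ u ∈ V, ((F.filter fun l => l.d u ≤ ρ / 2).card : ℝ) := by
          exact_mod_cast (Finset.card_le_card hcov).trans Finset.card_biUnion_le
      _ ≤ V.card * K ρ := by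
          rw [← nsmul_eq_mul]; exact Finset.sum_le_card_nsmul _ _ _ hone
      _ ≤ _ := mul_le_mul_of_nonneg_right hVcard (hK ρ hρ)

/-! ### Density and multiplicity of a refinement -/

/-- A collection of large mass has large density, since it has at most `≲ δ^(-3 - η)` tubes, each of
volume `≲ δ³`. -/
theorem mass_le_density (C : ShadedTubes 4 δ) {η : ℝ} (hδ : 0 < δ) (hδ1 : δ ≤ 1)
    (hd : C.EssentiallyDistinct) (hs : C.StickyCovered η) :
    C.mass ≤ 300000000000 * δ ^ (-η) * C.density := by
  rcases C.tubes.eq_empty_or_nonempty with h0 | hne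
  · simp [mass, density, h0]
  have hcard : (C.tubes.card : ℝ) ≤ 300000 * (1 / δ) ^ 3 * δ ^ (-η) :=
    C.card_le_of_norm_dir_sub_le hδ hδ1 hd hs hδ1 le_rfl 0 fun l _ => by simp [l.dir_norm]
  have hpos : (0 : ℝ) < C.tubes.card := by exact_mod_cast hne.card_pos
  have hterm : ∀ l ∈ C.tubes, volume.real (C.shading l) ≤
      1000000 * δ ^ 3 * (volume.real (C.shading l) / volume.real (l.tube δ)) := by
    intro l hl
    obtain ⟨htop, hvol⟩ := l.volume_real_tube_le hδ hδ1
    have hle : volume.real (C.shading l) ≤ volume.real (l.tube δ) :=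
      measureReal_mono (Set.iUnion₂_subset fun k hk => C.subset_tube l hl k hk) htop
    rcases (measureReal_nonneg (μ := volume) (s := l.tube δ)).eq_or_lt with h | h
    · rw [← h] at hle ⊢
      simpa using hle
    · calc volume.real (C.shading l)
          = volume.real (l.tube δ) * (volume.real (C.shading l) / volume.real (l.tube δ)) := by
            field_simp
        _ ≤ _ := by gcongr
  have hsum : ∑ l ∈ C.tubes, volume.real (C.shading l) / volume.real (l.tube δ) =
      C.tubes.card * C.density := by
    rw [density]; field_simp
  have hden : 0 ≤ C.density := by
    rw [density]; positivity
  calc C.mass ≤ 1000000 * δ ^ 3 * (C.tubes.card * C.density) := by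
        rw [mass, ← hsum, Finset.mul_sum]
        exact Finset.sum_le_sum hterm
    _ ≤ 1000000 * δ ^ 3 * (300000 * (1 / δ) ^ 3 * δ ^ (-η) * C.density) := by gcongr
    _ = _ := by field_simp; ring

/-- The two-ends condition with exponent `1` only asks that the density is not too small, as a ball
of radius `r` contains at most `≲ r / δ` cubes of a tube. -/
theorem twoEnds_one (C : ShadedTubes 4 δ) {c : ℝ} (hδ : 0 < δ) (hc : 352947 ≤ c * C.density) :
    C.TwoEnds 1 c := by
  classical
  intro l hl r hr _ x
  have h := l.card_cubes_le (L := 2 * r) (a := x 3 - r) hδ (by linarith)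
    ((C.Y l).filter fun k => cube 4 δ k ⊆ Metric.closedBall x r)
    (fun k hk => C.subset_tube l hl k (Finset.mem_filter.1 hk).1) (fun k hk => by
      have h1 := (Finset.mem_filter.1 hk).2 (cube_corner_mem hδ k)
      rw [Metric.mem_closedBall, dist_eq_norm] at h1
      have h2 := (PiLp.norm_apply_le _ 3).trans h1
      rw [Real.norm_eq_abs, abs_le] at h2
      simp only [PiLp.sub_apply] at h2
      constructor <;> linarith)
  have hr1 : 1 ≤ r / δ := (one_le_div hδ).2 hr
  rw [Real.rpow_one]
  calc _ ≤ 117649 * (2 * r / δ + 1) := by convert h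
    _ ≤ 352947 * (r / δ) := by rw [mul_div_assoc]; linarith
    _ ≤ c * C.density * (r / δ) := by gcongr
    _ = _ := by ring

theorem rpow_le_multiplicity (C : ShadedTubes 4 δ) {a b : ℝ} (hδ : 0 < δ) (hm : δ ^ a ≤ C.mass)
    (hv : volume.real C.union ≤ δ ^ b) : δ ^ (a - b) ≤ C.multiplicity := by
  have hmass := (Real.rpow_pos_of_pos hδ a).trans_le hm
  have hpos := (pow_pos hδ 4).trans_le (C.union_pos_of_mass_pos hδ hmass)
  rw [multiplicity_eq hδ, Real.rpow_sub hδ]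
  gcongr

end ShadedTubes

/-! ### The refinement -/

theorem tendsto_rpow_nhdsGT_zero {a : ℝ} (ha : 0 < a) :
    Tendsto (fun δ : ℝ => δ ^ a) (𝓝[>] 0) (𝓝 0) := by
  have h := (Real.continuous_rpow_const ha.le).tendsto 0
  rw [Real.zero_rpow ha.ne'] at h
  exact h.mono_left nhdsWithin_le_nhds

/-- Every `r` in `(δ^(1 - κ), 1]` is comparable, up to a factor `δ^(-κ)`, to one of the `1 / κ`
scales `δ^(κ j)` that are at least `δ^(1 - κ)`. -/
theorem exists_scale {κ r : ℝ} {m : ℕ} (hδ : 0 < δ) (hκ : κ * m = 1) (hr : δ ^ (1 - κ) < r)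
    (hr1 : r ≤ 1) : ∃ j < m, r ≤ δ ^ (κ * j) ∧ δ ^ (κ * j) ≤ r * δ ^ (-κ) := by
  obtain ⟨m, rfl⟩ : ∃ m', m = m' + 1 := Nat.exists_eq_succ_of_ne_zero (by rintro rfl; simp at hκ)
  by_contra! hcon
  have hall : ∀ j : ℕ, j ≤ m → r ≤ δ ^ (κ * j) := by
    intro j
    induction j with
    | zero => intro _; simpa using hr1
    | succ j ih =>
      intro hj
      have h := hcon j (by omega) (ih (by omega))
      have e : δ ^ (κ * (j + 1 : ℕ)) = δ ^ (κ * j) * δ ^ κ := by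
        rw [← Real.rpow_add hδ]; push_cast; ring_nf
      rw [Real.rpow_neg hδ.le, ← div_eq_mul_inv, div_lt_iff₀ (Real.rpow_pos_of_pos hδ _)] at h
      rw [e]
      exact h.le
  have h := hall m le_rfl
  rw [show κ * (m : ℝ) = 1 - κ by push_cast at hκ; linarith] at h
  linarith

namespace ShadedTubes

/-- The refinement, for parameters `κ = 1 / m` and `η` that are small in terms of `ε`, `σ`, `s` and
`t`, and for `δ` so small that `δ^(-η)` beats every constant. -/
theorem IsExtremal.exists_refinement {C : ShadedTubes 4 δ} {ε η κ s t δ₁ : ℝ} {m : ℕ}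
    (hC : C.IsExtremal η) (hδ : 0 < δ) (hδ1 : δ < 1) (hε : 0 < ε) (hs : 0 < s) (ht : 0 < t)
    (hη : 0 < η) (hκ : 0 < κ) (hκm : κ * m = 1) (hκε : 3 * κ ≤ ε) (hκσ : κ * sigma 4 ≤ ε / 2)
    (hηε : 8 * η ≤ ε) (hηt : 2 * η ≤ κ * t) (hηs : 4 * η ≤ κ * s)
    (hM : ∀ δ' : ℝ, 0 < δ' → δ' < δ₁ → ∀ D : ShadedTubes 4 δ', D.Admissible s t →
      δ' ^ (sigma 4 + ε / 2) ≤ volume.real D.union)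
    (hδκ : δ ^ κ < δ₁) (hδκ' : δ ^ κ ≤ 1 / 4)
    (hsmall : 10000000000000000000000000 * m * δ ^ η ≤ 1) :
    ∃ C' : ShadedTubes 4 δ, C'.IsRefinement (δ ^ η) C ∧ C'.TwoEnds 1 (δ ^ (-4 * η)) ∧
      C'.RobustlyTransverse (sigma 4) (δ ^ (-3 * η - 3 * ε)) := by
  classical
  have hσ := sigma_nonneg 4
  set σ := sigma 4 with hσdef
  obtain ⟨⟨hdist, hstick, hmass⟩, hvol⟩ := hC
  have hpos : ∀ a : ℝ, 0 < δ ^ a := fun a => Real.rpow_pos_of_pos hδ a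
  have hmono : ∀ {a b : ℝ}, a ≤ b → δ ^ b ≤ δ ^ a := fun h =>
    Real.rpow_le_rpow_of_exponent_ge hδ hδ1.le h
  have hm : (1 : ℝ) ≤ m := by
    have : m ≠ 0 := by rintro rfl; simp at hκm
    exact_mod_cast Nat.one_le_iff_ne_zero.2 this
  have hδη : 10000000000000000000000000 * δ ^ η ≤ 1 := by
    refine le_trans ?_ hsmall
    have := hpos η
    nlinarith
  have hx : 10000000000000000000000000 ≤ δ ^ (-η) := by
    rw [Real.rpow_neg hδ.le, ← one_div, le_div_iff₀ (hpos η)]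
    exact hδη
  have hxx : δ ^ (-η) * δ ^ (-η) = δ ^ (-(2 * η)) := by
    rw [← Real.rpow_add hδ]; ring_nf
  -- The scales at which heavy cubes are removed.
  set P : Finset ℝ := (Finset.range m).image fun j : ℕ => δ ^ (κ * j) with hP
  set K : ℝ → ℝ := fun ρ => δ ^ (-ε) * (δ / ρ) ^ (-σ) with hK
  have hPmem : ∀ ρ ∈ P, 0 < ρ ∧ δ ≤ ρ ∧ ρ ≤ 1 ∧ δ / ρ ≤ δ ^ κ := by
    intro ρ hρ
    obtain ⟨j, hj, rfl⟩ := Finset.mem_image.1 hρ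
    have hj1 : (j : ℝ) + 1 ≤ m := by exact_mod_cast Finset.mem_range.1 hj
    have hj2 : κ * j + κ ≤ 1 := by nlinarith
    refine ⟨hpos _, ?_, ?_, ?_⟩
    · simpa using hmono (show κ * j ≤ 1 by linarith)
    · simpa using hmono (show 0 ≤ κ * j by positivity)
    · rw [div_le_iff₀ (hpos _), ← Real.rpow_add hδ]
      simpa using hmono (show κ + κ * j ≤ 1 by linarith)
  have hheavy : ∀ ρ ∈ P, ∀ u, (∑ l ∈ C.coveredBy u ρ, ((C.heavy u ρ (K ρ) l).card : ℝ)) * δ ^ 4 ≤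
      40000000000000000000 * δ ^ (-η) * δ ^ (κ * s) * ρ ^ 3 := by
    intro ρ hρ u
    obtain ⟨hρ0, hρδ, hρ1, hρκ⟩ := hPmem ρ hρ
    have hδ' : 0 < δ / ρ := by positivity
    refine (C.sum_card_heavy_le (s := s) (t := t) (η := η) (θ := (δ / ρ) ^ (σ + ε / 2)) hδ hρ0 hρ1
      (hρκ.trans hδκ') hdist hstick ?_ (hM _ hδ' (hρκ.trans_lt hδκ)) (by positivity) ?_ u).trans ?_
    · calc 10000000000000 * δ ^ (-η) ≤ δ ^ (-η) * δ ^ (-η) := by gcongr; linarith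
        _ ≤ δ ^ (-(κ * t)) := by rw [hxx]; exact hmono (by linarith)
        _ = (δ ^ κ) ^ (-t) := by rw [← Real.rpow_mul hδ.le]; ring_nf
        _ ≤ (δ / ρ) ^ (-t) := Real.rpow_le_rpow_of_nonpos hδ' hρκ (by linarith)
    · have e : K ρ * (δ / ρ) ^ (σ + ε / 2) = δ ^ (-ε) * (δ / ρ) ^ (ε / 2) := by
        rw [hK]
        dsimp only
        rw [mul_assoc, ← Real.rpow_add hδ']; ring_nf
      rw [e]
      calc 200000000000 * δ ^ (-η) < δ ^ (-η) * δ ^ (-η) := by gcongr; linarith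
        _ ≤ δ ^ (-ε) * δ ^ (ε / 2) := by
            rw [hxx, ← Real.rpow_add hδ]; exact hmono (by linarith)
        _ ≤ δ ^ (-ε) * (δ / ρ) ^ (ε / 2) := by
            gcongr
            exact le_div_self hδ.le hρ0 hρ1
    · calc _ ≤ 40000000000000000000 * δ ^ (-η) * ρ ^ 3 * (δ ^ κ) ^ s := by gcongr
        _ = _ := by rw [← Real.rpow_mul hδ.le]; ring
  obtain ⟨bad, hmass', hcone⟩ := C.exists_pruned hδ (by positivity) P K
    (fun ρ hρ => by have := (hPmem ρ hρ).1; positivity)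
    (fun ρ hρ => ⟨(hPmem ρ hρ).2.1, (hPmem ρ hρ).2.2.1⟩) hstick hheavy
  set C' := C.prune bad with hC'
  have hdist' : C'.EssentiallyDistinct := hdist
  have hstick' : C'.StickyCovered η := hstick
  have hhalf : C.mass / 2 ≤ C'.mass := by
    refine le_trans ?_ hmass'
    have hcard : (P.card : ℝ) ≤ m := by
      exact_mod_cast Finset.card_image_le.trans (by simp)
    have h1 : P.card * (40000 * δ ^ (-η) * (40000000000000000000 * δ ^ (-η) * δ ^ (κ * s))) ≤
        m * (1600000000000000000000000 * δ ^ η * δ ^ η) := by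
      calc _ ≤ m * (40000 * δ ^ (-η) * (40000000000000000000 * δ ^ (-η) * δ ^ (4 * η))) := by
            have := hmono hηs
            gcongr
        _ = _ := by
            rw [show δ ^ (4 * η) = δ ^ η * δ ^ η * δ ^ (η + η) by
              simp only [← Real.rpow_add hδ]; ring_nf, Real.rpow_add hδ, Real.rpow_neg hδ.le]
            have := hpos η
            field_simp
            ring
    have h2 := mul_le_mul_of_nonneg_right hsmall (hpos η).le
    have h3 := mul_nonneg (mul_nonneg (show (0 : ℝ) ≤ m by positivity) (hpos η).le) (hpos η).le
    linarith
  have hmass2 : δ ^ (2 * η) ≤ C'.mass := by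
    rw [two_mul, Real.rpow_add hδ]
    have := hpos η
    nlinarith
  have hvol' : volume.real C'.union ≤ δ ^ (σ - η) := by
    refine le_trans ?_ hvol
    rw [volume_real_union hδ, volume_real_union hδ]
    gcongr
    exact Finset.biUnion_mono fun l _ => Finset.sdiff_subset
  refine ⟨C', ⟨le_rfl, fun l _ => ?_, ?_⟩, ?_, ?_⟩
  · exact Set.biUnion_subset_biUnion_left fun k hk => (Finset.mem_sdiff.1 hk).1
  · have := hpos η
    nlinarith
  · refine C'.twoEnds_one hδ ?_
    have h1 := hmass2.trans (C'.mass_le_density hδ hδ1.le hdist' hstick')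
    have e : δ ^ (-4 * η) = δ ^ (-η) * δ ^ (-η) * (δ ^ (2 * η))⁻¹ := by
      rw [hxx, ← Real.rpow_neg hδ.le, ← Real.rpow_add hδ]; ring_nf
    have h2 : 1 ≤ (δ ^ (2 * η))⁻¹ * (300000000000 * δ ^ (-η) * C'.density) := by
      rw [← div_eq_inv_mul, one_le_div (hpos _)]
      exact h1
    rw [e]
    calc (352947 : ℝ) ≤ δ ^ (-η) / 300000000000 * 1 := by linarith
      _ ≤ δ ^ (-η) / 300000000000 *
          ((δ ^ (2 * η))⁻¹ * (300000000000 * δ ^ (-η) * C'.density)) := by gcongr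
      _ = _ := by ring
  · intro k v r hr hr1
    have hr0 : 0 < r := hδ.trans_le hr
    have hμ := C'.rpow_le_multiplicity hδ hmass2 hvol'
    -- It suffices to bound the number of tubes in the cone by `(r / δ)^σ δ^(-3ε)`.
    suffices h : (((C'.through k).filter fun l => angle l.dir v ≤ r).card : ℝ) ≤
        r ^ σ * (δ ^ (-(3 * ε)) * δ ^ (-σ)) by
      refine h.trans ?_
      calc r ^ σ * (δ ^ (-(3 * ε)) * δ ^ (-σ))
          = r ^ σ * δ ^ (-3 * η - 3 * ε) * δ ^ (2 * η - (σ - η)) := by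
            rw [mul_assoc, ← Real.rpow_add hδ, ← Real.rpow_add hδ]; ring_nf
        _ ≤ _ := by gcongr
    have hrσ : 1 ≤ r ^ σ * δ ^ (-σ) := by
      rw [Real.rpow_neg hδ.le, ← div_eq_mul_inv, one_le_div (hpos σ)]
      exact Real.rpow_le_rpow hδ.le hr hσ
    rcases le_or_gt r (δ ^ (1 - κ)) with hsm | hlg
    · -- At angles close to `δ` the number of tubes of the whole collection is small enough.
      set F := (C'.through k).filter fun l => angle l.dir v ≤ r with hF
      rcases F.eq_empty_or_nonempty with h0 | ⟨l₀, hl₀⟩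
      · rw [h0]; simp only [Finset.card_empty, Nat.cast_zero]; positivity
      have h1 : (F.card : ℝ) ≤ 300000 * (2 * r / δ) ^ 3 * δ ^ (-η) := by
        refine C'.card_le_of_norm_dir_sub_le hδ hδ1.le hdist' hstick' (by linarith)
          ((Finset.filter_subset _ _).trans (Finset.filter_subset _ _)) l₀.dir fun l hl => ?_
        have h1 := angle_le_angle_add_angle l.dir v l₀.dir
        rw [angle_comm v] at h1
        linarith [l.norm_dir_sub_le_angle l₀, (Finset.mem_filter.1 hl).2,
          (Finset.mem_filter.1 hl₀).2]
      have h2 : r / δ ≤ δ ^ (-κ) := by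
        rw [div_le_iff₀ hδ]
        calc r ≤ δ ^ (1 - κ) := hsm
          _ = δ ^ (-κ) * δ := by rw [← Real.rpow_add_one hδ.ne']; ring_nf
      calc (F.card : ℝ) ≤ 300000 * (2 * (r / δ)) ^ 3 * δ ^ (-η) := by rwa [← mul_div_assoc]
        _ ≤ 300000 * (2 * δ ^ (-κ)) ^ 3 * δ ^ (-η) := by gcongr
        _ = 2400000 * (δ ^ (-κ)) ^ 3 * δ ^ (-η) := by ring
        _ ≤ δ ^ (-η) * (δ ^ (-κ)) ^ 3 * δ ^ (-η) := by gcongr; linarith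
        _ = δ ^ (-η + -κ * 3 + -η) := by
            rw [Real.rpow_add hδ, Real.rpow_add hδ, Real.rpow_mul hδ.le (-κ) 3]
            norm_cast
        _ ≤ δ ^ (-(3 * ε)) := hmono (by linarith)
        _ ≤ δ ^ (-(3 * ε)) * (r ^ σ * δ ^ (-σ)) := le_mul_of_one_le_right (hpos _).le hrσ
        _ = _ := by ring
    · obtain ⟨j, hj, hrj, hjr⟩ := exists_scale hδ hκm hlg hr1
      have hρP : δ ^ (κ * j) ∈ P := Finset.mem_image.2 ⟨j, Finset.mem_range.2 hj, rfl⟩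
      refine (hcone _ hρP k v r hrj).trans ?_
      rw [hK]
      dsimp only
      have h1 : (δ / δ ^ (κ * j)) ^ (-σ) ≤ r ^ σ * δ ^ (-σ) * δ ^ (-(ε / 2)) := by
        rw [Real.rpow_neg (by positivity), ← Real.inv_rpow (by positivity), inv_div]
        calc (δ ^ (κ * j) / δ) ^ σ ≤ (r * δ ^ (-κ) / δ) ^ σ := by gcongr
          _ = r ^ σ * δ ^ (-σ) * δ ^ (-(κ * σ)) := by
              rw [Real.div_rpow (by positivity) hδ.le, Real.mul_rpow hr0.le (hpos _).le,
                ← Real.rpow_mul hδ.le, Real.rpow_neg hδ.le σ, neg_mul]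
              ring
          _ ≤ _ := by
              have : δ ^ (-(κ * σ)) ≤ δ ^ (-(ε / 2)) := hmono (by linarith)
              gcongr
      calc 1000000 * δ ^ (-η) * (δ ^ (-ε) * (δ / δ ^ (κ * j)) ^ (-σ))
          ≤ δ ^ (-η) * δ ^ (-η) * (δ ^ (-ε) * (r ^ σ * δ ^ (-σ) * δ ^ (-(ε / 2)))) := by
            gcongr
            linarith
        _ = r ^ σ * (δ ^ (-(2 * η) + -ε + -(ε / 2)) * δ ^ (-σ)) := by
            rw [hxx, Real.rpow_add hδ, Real.rpow_add hδ]; ring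
        _ ≤ r ^ σ * (δ ^ (-(3 * ε)) * δ ^ (-σ)) := by
            have : δ ^ (-(2 * η) + -ε + -(ε / 2)) ≤ δ ^ (-(3 * ε)) := hmono (by linarith)
            gcongr

end ShadedTubes
end StickyKakeya

theorem mainTheorem5 (ε : ℝ) (hε : 0 < ε) :
    ∃ η₀ : ℝ, 0 < η₀ ∧ ∀ η : ℝ, 0 < η → η ≤ η₀ →
      ∃ δ₀ : ℝ, 0 < δ₀ ∧ ∀ δ : ℝ, 0 < δ → δ < δ₀ →
        ∀ C : StickyKakeya.ShadedTubes 4 δ, C.IsExtremal η →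
          ∃ C' : StickyKakeya.ShadedTubes 4 δ,
            C'.IsRefinement (δ ^ η) C ∧
            C'.TwoEnds 1 (δ ^ (-4 * η)) ∧
            C'.RobustlyTransverse (StickyKakeya.sigma 4) (δ ^ (-3 * η - 3 * ε)) := by
  obtain ⟨s, t, δ₁, hs, ht, hδ₁, hM⟩ := StickyKakeya.exists_rpow_le_volume_union 4 (half_pos hε)
  have hσ := StickyKakeya.sigma_nonneg 4
  obtain ⟨m, hm⟩ := exists_nat_ge (3 / ε + 2 * StickyKakeya.sigma 4 / ε + 1)
  have h1 : 0 < 3 / ε := by positivity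
  have h2 : 0 ≤ 2 * StickyKakeya.sigma 4 / ε := by positivity
  have hm0 : (0 : ℝ) < m := by linarith
  have hκ : (0 : ℝ) < 1 / m := by positivity
  refine ⟨min (ε / 8) (min (1 / m * t / 2) (1 / m * s / 4)), by positivity, fun η hη hη₀ => ?_⟩
  rw [le_min_iff, le_min_iff] at hη₀
  have hev : ∀ᶠ δ : ℝ in 𝓝[>] 0, δ < 1 ∧ δ ^ (1 / m : ℝ) < min δ₁ (1 / 4) ∧
      δ ^ η < 1 / (10000000000000000000000000 * m) := by
    filter_upwards [StickyKakeya.eventually_mem_Ioo_zero_one,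
      (StickyKakeya.tendsto_rpow_nhdsGT_zero hκ).eventually
        (gt_mem_nhds (show 0 < min δ₁ (1 / 4) by positivity)),
      (StickyKakeya.tendsto_rpow_nhdsGT_zero hη).eventually
        (gt_mem_nhds (show 0 < 1 / (10000000000000000000000000 * (m : ℝ)) by positivity))]
      with δ h1 h2 h3 using ⟨h1.2, h2, h3⟩
  obtain ⟨δ₀, hδ₀, hsub⟩ := mem_nhdsGT_iff_exists_Ioo_subset.1 hev
  refine ⟨δ₀, hδ₀, fun δ hδ hδδ₀ C hC => ?_⟩
  obtain ⟨hδ1, hδκ, hδη⟩ := hsub ⟨hδ, hδδ₀⟩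
  rw [lt_min_iff] at hδκ
  refine hC.exists_refinement hδ hδ1 hε hs ht hη hκ (one_div_mul_cancel hm0.ne') ?_ ?_
    (by linarith) (by linarith) (by linarith) hM hδκ.1 hδκ.2.le ?_
  · rw [mul_one_div, div_le_iff₀ hm0, ← div_le_iff₀' hε]
    linarith
  · rw [one_div_mul_eq_div, div_le_iff₀ hm0]
    have h3 : 2 * StickyKakeya.sigma 4 / ε ≤ m := by linarith
    rw [div_le_iff₀ hε] at h3
    linarith
  · rw [lt_div_iff₀ (by positivity)] at hδη
    linarith
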